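/- Throughout, $0<q<1$; $\alpha,\lambda,a,b$ are complex; for $p\in\mathbb C$, $0<|p|<1$, $$(x;p)_n=\prod_{k=0}^{n-1}(1-xp^k),\quad (x;p)_\infty=\prod_{k=0}^{\infty}(1-xp^k),\quad (x_1,\dots,x_r;p)_n=(x_1;p)_n\cdots(x_r;p)_n\ (n\in\mathbb N\cup\{\infty\}),$$ $${}_{s+1}\phi_s\left({x_1,\dots,x_{s+1}\atop y_1,\dots,y_s};p,z\right)=\sum_{n=0}^\infty\frac{(x_1,\dots,x_{s+1};p)_n}{(p,y_1,\dots,y_s;p)_n}z^n ,$$ where a series with an upper parameter $p^{-m}$, $m\in\mathbb N$, is understood as terminating at $n=m$. **(i)** Let $m\ge 0$ be an integer, $\alpha,\lambda,a,b\ne0$, and let all denominators in the following formula (for $0\le n\le m$) be nonzero. Then $$\frac{(\alpha^2 q^2, \alpha^2 ab/q^2; q^2)_m}{(\alpha^2 a, \alpha^2 b; q^2)_m}\,{}_5\phi_4\left({q^{-2m}, q^2/a, q^2/b, \lambda, q\lambda \atop \alpha, q\alpha, q^2\lambda^2, q^4/(\alpha^2 ab q^{2m})}; q^2, q^2 \right)$$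 $$=\sum_{n=0}^m \frac{(1-\alpha^2 q^{4n})(q^{-2m}, \alpha^2, q^2/a, q^2/b; q^2)_n (-q, \alpha /\lambda; q)_n (\alpha^2 \lambda ab q^{2m-2})^n}{(1-\alpha^2)(q^2, \alpha^2 q^{2m+2}, \alpha^2 a, \alpha^2 b; q^2)_n (\alpha, -q\lambda; q)_n}.$$ **(ii)** Let $m\ge 0$ be an integer, $\alpha,\lambda,a,b\ne0$, and let all denominators in the following formula (for $0\le n\le m$) be nonzero. Then $$\frac{(\alpha^2 q^2, \alpha^2 ab/q^2; q^2)_m}{(\alpha^2 a, \alpha^2 b; q^2)_m}\,{}_5\phi_4\left({q^{-2m}, q^2/a, q^2/b, \lambda, q\lambda \atop q\alpha, q^2\alpha, \lambda^2, q^4/(\alpha^2 ab q^{2m})}; q^2, q^2 \right)$$ $$=\sum_{n=0}^m \frac{(1+\alpha q^{2n})(q^{-2m}, \alpha^2, q^2/a, q^2/b; q^2)_n (-q, q\alpha /\lambda; q)_n (\alpha^2 \lambda ab q^{2m-2})^n}{(1+\alpha)(q^2, \alpha^2 q^{2m+2}, \alpha^2 a, \alpha^2 b; q^2)_n (\alpha,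 -\lambda; q)_n}.$$ **(iii)** The limiting cases $m\to\infty$: if $\lambda,a,b\neq 0$, $|\alpha^2ab/q^2|<1$ and all denominators in the formula concerned (for all $n\ge0$) are nonzero, then the series below converge absolutely and $$\frac{(\alpha^2 q^2, \alpha^2 ab/q^2; q^2)_\infty}{(\alpha^2 a, \alpha^2 b; q^2)_\infty}\,{}_4\phi_3\left({q^2/a, q^2/b, \lambda, q\lambda \atop \alpha, q\alpha, q^2\lambda^2 }; q^2, \frac{\alpha^2 ab}{q^2} \right) =\sum_{n=0}^\infty \frac{(1-\alpha^2 q^{4n})( \alpha^2, q^2/a, q^2/b; q^2)_n (-q, \alpha /\lambda; q)_n (-\alpha^2 \lambda ab)^n q^{n^2-3n}}{(1-\alpha^2)(q^2, \alpha^2 a, \alpha^2 b; q^2)_n (\alpha, -q\lambda; q)_n},$$ $$\frac{(\alpha^2 q^2, \alpha^2 ab/q^2; q^2)_\infty}{(\alpha^2 a, \alpha^2 b; q^2)_\infty}\,{}_4\phi_3\left({q^2/a, q^2/b, \lambda, q\lambda \atop q\alpha, q^2\alpha, \lambda^2}; q^2, \frac{\alpha^2 ab}{q^2} \right) =\sum_{n=0}^\infty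 \frac{(1+\alpha q^{2n})(\alpha^2, q^2/a, q^2/b; q^2)_n (-q, q\alpha /\lambda; q)_n (-\alpha^2 \lambda ab )^nq^{n^2-3n}}{(1+\alpha)(q^2, \alpha^2 a, \alpha^2 b; q^2)_n (\alpha, -\lambda; q)_n}.$$ **(iv)** The Rogers–Selberg identities modulo 7 hold (all series being absolutely convergent): $$\sum_{n=0}^\infty \frac{q^{2n^2+2n}}{(-q; q)_{2n}(q^2; q^2)_n}=\frac{1}{(q^2; q^2)_\infty} \sum_{n=-\infty}^\infty (-1)^n q^{(7n^2+3n)/2}=\frac{(q^2, q^5, q^7; q^7)_\infty}{(q^2; q^2)_\infty},$$ $$\sum_{n=0}^\infty \frac{q^{2n^2+2n}}{(-q; q)_{2n+1}(q^2; q^2)_n}=\frac{(q, q^6, q^7; q^7)_\infty}{(q^2; q^2)_\infty},\qquad \sum_{n=0}^\infty \frac{q^{2n^2}}{(-q; q)_{2n}(q^2; q^2)_n}=\frac{(q^3, q^4, q^7; q^7)_\infty}{(q^2; q^2)_\infty}.$$ -/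

import Mathlib

set_option maxHeartbeats 4000000

noncomputable section

/-- The `q`-shifted factorial `(a; q)_n = ∏_{k=0}^{n-1} (1 - a q^k)`. -/
def qPoch (a q : ℂ) (n : ℕ) : ℂ := ∏ k ∈ Finset.range n, (1 - a * q ^ k)

/-- The infinite `q`-shifted factorial `(a; q)_∞ = ∏_{k=0}^∞ (1 - a q^k)`
(the product converges absolutely whenever `|q| < 1`). -/
def qPochInf (a q : ℂ) : ℂ := ∏' k : ℕ, (1 - a * q ^ k)

/-- The compact notation `(a₁, …, a_r; q)_n = (a₁; q)_n ⋯ (a_r; q)_n`. -/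
def qPochs (as : List ℂ) (q : ℂ) (n : ℕ) : ℂ := (as.map fun a => qPoch a q n).prod

/-- The compact notation `(a₁, …, a_r; q)_∞ = (a₁; q)_∞ ⋯ (a_r; q)_∞`. -/
def qPochsInf (as : List ℂ) (q : ℂ) : ℂ := (as.map fun a => qPochInf a q).prod

/-- The `n`-th term of the basic hypergeometric series `_rφ_s(a₁, …, a_r; b₁, …, b_s; q, z)`:
`(a₁, …, a_r; q)_n / (q, b₁, …, b_s; q)_n * ((-1)^n q^{n(n-1)/2})^{1+s-r} * z^n`.
A series that terminates because of an upper parameter `q^{-m}` has zero terms for `n > m`. -/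
def phiTerm (as bs : List ℂ) (q z : ℂ) (n : ℕ) : ℂ :=
  qPochs as q n / qPochs (q :: bs) q n *
    ((-1) ^ n * q ^ (n * (n - 1) / 2)) ^ (1 + (bs.length : ℤ) - (as.length : ℤ)) * z ^ n

/-- The basic hypergeometric series `_rφ_s(a₁, …, a_r; b₁, …, b_s; q, z)`. -/
def phi (as bs : List ℂ) (q z : ℂ) : ℂ := ∑' n : ℕ, phiTerm as bs q z n

end

/-!
The two transformations are instances of Bailey's lemma in base `q²`, relative to `α²`, with
`ρ₁ = q² / a` and `ρ₂ = q² / b`: the left-hand sides are sums over the `B`-sequence of a Bailey pair,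
the right-hand sides sums over its `A`-sequence. Bailey's lemma itself (`IsBaileyPair.sum_eq`) is an
interchange of summations followed by the `q`-Pfaff–Saalschütz sum (`saalschutz`).

What is special is that the two Bailey pairs exist. For the second one, `(x²; q²)_n = (x, -x; q)_n`
turns the defining sum into a very-well-poised `₆φ₅` in base `q` with `A = -α` and the two upper
parameters `±q^{-n}`; it is summed by Bailey's lemma in base `q` applied to the unit pair
(`six_phi_five`). The terms of the first pair at `λ` are those of the second at `q λ` times
`(q^{-r} - α q^r) / (1 - α)`, and that factor splits the sum into two `₆φ₅` sums, of lengths `n` and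
`n - 1` (`isBaileyPair_first`).

Upper parameters enter through `∏ (x - y q^k)` rather than `(y / x; q)_n`, so that `x = 0` encodes the
limit of a parameter tending to infinity and needs no separate passage to the limit. A Bailey pair
relative to `α²` requires `(α² q²; q²)_{2m} ≠ 0`, which the hypotheses do not give (`α = -q^{-k}` is
allowed); those `α` are isolated and are reached by continuity (`bailey_sum_eq_of_eventually`).

The limit `m → ∞` is Tannery's theorem (`tsum_eq_of_finite`). Setting `a`, `b`, `λ` to zero and
`α = -q` or `α = -1` turns the right-hand sides into theta series in base `q⁷`, which the Jacobi
triple product (`hasSum_triple_product`) factors; the latter follows from the `q`-binomial theorem, a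
degenerate case of `saalschutz`.
-/

noncomputable section

open Filter Topology

/-! ### Shifted factorials -/

/-- The homogeneous `q`-shifted factorial `∏_{k=0}^{n-1} (x - y q^k) = x^n (y/x; q)_n`.  It stays
meaningful at `x = 0`, which encodes the limit of an upper parameter `y / x` tending to infinity. -/
def qPochHom (x y q : ℂ) (n : ℕ) : ℂ := ∏ k ∈ Finset.range n, (x - y * q ^ k)

lemma qPochHom_zero (x y q : ℂ) : qPochHom x y q 0 = 1 := by simp [qPochHom]

lemma qPochHom_succ (x y q : ℂ) (n : ℕ) :
    qPochHom x y q (n + 1) = qPochHom x y q n * (x - y * q ^ n) := by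
  simp [qPochHom, Finset.prod_range_succ]

lemma qPoch_zero (a q : ℂ) : qPoch a q 0 = 1 := by simp [qPoch]

lemma qPoch_succ (a q : ℂ) (n : ℕ) : qPoch a q (n + 1) = qPoch a q n * (1 - a * q ^ n) := by
  simp [qPoch, Finset.prod_range_succ]

lemma qPoch_add (a q : ℂ) (m n : ℕ) :
    qPoch a q (m + n) = qPoch a q m * qPoch (a * q ^ m) q n := by
  simp only [qPoch, Finset.prod_range_add, pow_add, mul_assoc]

lemma qPochHom_add (x y q : ℂ) (m n : ℕ) :
    qPochHom x y q (m + n) = qPochHom x y q m * qPochHom x (y * q ^ m) q n := by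
  simp only [qPochHom, Finset.prod_range_add, pow_add, mul_assoc]

lemma qPoch_ne_zero_of_le {a q : ℂ} {m n : ℕ} (h : qPoch a q n ≠ 0) (hmn : m ≤ n) :
    qPoch a q m ≠ 0 := by
  obtain ⟨k, rfl⟩ := Nat.exists_eq_add_of_le hmn
  rw [qPoch_add] at h
  exact left_ne_zero_of_mul h

lemma qPoch_shift_ne_zero {a q : ℂ} {m n : ℕ} (h : qPoch a q (m + n) ≠ 0) :
    qPoch (a * q ^ m) q n ≠ 0 := by
  rw [qPoch_add] at h
  exact right_ne_zero_of_mul h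

lemma qPoch_self_ne_zero {q : ℂ} (hq : ∀ k : ℕ, q ^ (k + 1) ≠ 1) (n : ℕ) : qPoch q q n ≠ 0 := by
  refine Finset.prod_ne_zero_iff.2 fun k _ => ?_
  rw [← pow_succ']
  exact sub_ne_zero.2 (hq k).symm

lemma pow_succ_ne_one_of_norm_lt_one {q : ℂ} (hq : ‖q‖ < 1) (k : ℕ) : q ^ (k + 1) ≠ 1 := by
  intro h
  have h1 : ‖q‖ ^ (k + 1) = 1 := by rw [← norm_pow, h, norm_one]
  exact (pow_lt_one₀ (norm_nonneg q) hq (Nat.succ_ne_zero k)).ne h1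

lemma norm_sq_lt_one {q : ℂ} (hq : ‖q‖ < 1) : ‖q ^ 2‖ < 1 := by
  rw [norm_pow]
  exact pow_lt_one₀ (norm_nonneg q) hq two_ne_zero

lemma qPoch_sq (x q : ℂ) (n : ℕ) : qPoch (x ^ 2) (q ^ 2) n = qPoch x q n * qPoch (-x) q n := by
  simp only [qPoch, ← Finset.prod_mul_distrib]
  exact Finset.prod_congr rfl fun k _ => by ring

lemma qPoch_two_mul (x q : ℂ) (n : ℕ) :
    qPoch x q (2 * n) = qPoch x (q ^ 2) n * qPoch (q * x) (q ^ 2) n := by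
  induction n with
  | zero => simp [qPoch_zero]
  | succ n ih =>
    rw [show 2 * (n + 1) = 2 * n + 1 + 1 by ring, qPoch_succ, qPoch_succ, ih, qPoch_succ,
      qPoch_succ]
    ring

lemma qPoch_succ' (a q : ℂ) (n : ℕ) : qPoch a q (n + 1) = (1 - a) * qPoch (a * q) q n := by
  rw [add_comm, qPoch_add, qPoch_succ, qPoch_zero]
  simp

lemma qPochHom_mul_left (c x y q : ℂ) (n : ℕ) :
    qPochHom (c * x) (c * y) q n = c ^ n * qPochHom x y q n := by
  induction n with
  | zero => simp [qPochHom_zero]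
  | succ n ih => rw [qPochHom_succ, qPochHom_succ, ih]; ring

/-! ### The q-Pfaff–Saalschütz sum and Bailey's lemma -/

/-- Telescoping certificate for the recurrence in `M = J + e` of the `q`-Pfaff–Saalschütz sum. -/
lemma saalschutz_partial_sum {p : ℂ} (hp : ∀ k : ℕ, p ^ (k + 1) ≠ 1) (u v s t y : ℂ) (J : ℕ) :
    ∀ e : ℕ, qPoch (y * s * t) p (J + e + 1) ≠ 0 →
    ∑ j ∈ Finset.range (J + 1),
      ((1 - p ^ (J + e + 1)) * (1 - y * s * t * p ^ (J + e)) *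
          (qPochHom u s p j * qPochHom v t p j * qPoch (y * u * v) p (J + e + 1 - j) * y ^ j /
            (qPoch p p (J + e + 1 - j) * qPoch p p j * qPoch (y * s * t) p j)) -
        (1 - y * t * u * p ^ (J + e)) * (1 - y * s * v * p ^ (J + e)) *
          (qPochHom u s p j * qPochHom v t p j * qPoch (y * u * v) p (J + e - j) * y ^ j /
            (qPoch p p (J + e - j) * qPoch p p j * qPoch (y * s * t) p j))) =
      -p ^ e * (qPochHom u s p (J + 1) * qPochHom v t p (J + 1) * qPoch (y * u * v) p e *
        y ^ (J + 1)) / (qPoch p p e * qPoch p p J * qPoch (y * s * t) p J) := by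
  induction J with
  | zero =>
    intro e h
    have h1 := qPoch_self_ne_zero hp e
    have h2 : 1 - p * p ^ e ≠ 0 := by rw [← pow_succ']; exact sub_ne_zero.2 (hp e).symm
    simp only [Finset.sum_range_one, zero_add, qPochHom_zero, qPoch_zero, Nat.sub_zero, pow_zero,
      qPochHom_succ, qPoch_succ, pow_succ']
    generalize qPoch (y * u * v) p e = Z at *
    generalize qPoch p p e = P2 at *
    generalize p ^ e = E at *
    generalize hw : 1 - p * E = w at *
    field_simp
    subst hw
    ring
  | succ J ih =>
    intro e h
    have e1 : J + 1 + e = J + (e + 1) := by omega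
    rw [Finset.sum_range_succ, e1, ih (e + 1) (by rwa [← e1])]
    have e2 : J + (e + 1) + 1 - (J + 1) = e + 1 := by omega
    have e3 : J + (e + 1) - (J + 1) = e := by omega
    rw [e2, e3]
    have h1 := qPoch_self_ne_zero hp e
    have h2 : 1 - p * p ^ e ≠ 0 := by rw [← pow_succ']; exact sub_ne_zero.2 (hp e).symm
    have h3 := qPoch_self_ne_zero hp J
    have h4 : 1 - p * p ^ J ≠ 0 := by rw [← pow_succ']; exact sub_ne_zero.2 (hp J).symm
    have h5 := qPoch_ne_zero_of_le h (show J + 1 ≤ _ by omega)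
    rw [qPoch_succ] at h5
    have h6 := left_ne_zero_of_mul h5
    have h7 := right_ne_zero_of_mul h5
    simp only [qPochHom_succ, qPoch_succ, pow_add, pow_one]
    clear ih h h5
    generalize qPochHom u s p J = H1
    generalize qPochHom v t p J = H2
    generalize qPoch (y * u * v) p e = Z at *
    generalize qPoch (y * s * t) p J = D at *
    generalize qPoch p p J = P1 at *
    generalize qPoch p p e = P2 at *
    generalize p ^ J = X at *
    generalize p ^ e = E at *
    generalize y ^ J = Y at *
    generalize hw : 1 - p * E = w at *
    generalize hw' : 1 - p * X = w' at *
    generalize hz : 1 - y * s * t * X = z at *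
    field_simp
    subst hw hw' hz
    ring

/-- The `q`-Pfaff–Saalschütz sum in homogeneous form.  With `B = s/u`, `C = t/v` and `D = y s t` it
is the usual sum with lower parameter `D` and argument parameter `D/(BC) = y u v`. -/
theorem saalschutz {p : ℂ} (hp : ∀ k : ℕ, p ^ (k + 1) ≠ 1) (u v s t y : ℂ) (M : ℕ)
    (h : qPoch (y * s * t) p M ≠ 0) :
    ∑ j ∈ Finset.range (M + 1),
      qPochHom u s p j * qPochHom v t p j * qPoch (y * u * v) p (M - j) * y ^ j /
            (qPoch p p (M - j) * qPoch p p j * qPoch (y * s * t) p j) =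
      qPoch (y * t * u) p M * qPoch (y * s * v) p M / (qPoch p p M * qPoch (y * s * t) p M) := by
  induction M with
  | zero => simp [qPoch_zero, qPochHom_zero]
  | succ M ih =>
    have h' := qPoch_ne_zero_of_le h (Nat.le_succ M)
    have key := saalschutz_partial_sum hp u v s t y M 0 h
    simp only [add_zero] at key
    rw [Finset.sum_sub_distrib, ← Finset.mul_sum, ← Finset.mul_sum, ih h'] at key
    rw [Finset.sum_range_succ, Nat.sub_self]
    have h3 := qPoch_self_ne_zero hp M
    have h4 : 1 - p * p ^ M ≠ 0 := by rw [← pow_succ']; exact sub_ne_zero.2 (hp M).symm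
    rw [qPoch_succ] at h
    have h7 := right_ne_zero_of_mul h
    have h8 : (1 - p ^ (M + 1)) * (1 - y * s * t * p ^ M) ≠ 0 := by
      rw [pow_succ']; exact mul_ne_zero h4 h7
    apply mul_left_cancel₀ h8
    rw [mul_add, sub_eq_iff_eq_add.1 key]
    clear key ih h
    simp only [qPochHom_succ, qPoch_succ, pow_succ', pow_zero, qPoch_zero] at *
    generalize qPochHom u s p M = H1
    generalize qPochHom v t p M = H2
    generalize qPoch (y * s * t) p M = D at *
    generalize qPoch p p M = P1 at *
    generalize p ^ M = X at *
    generalize hw : 1 - p * X = w at *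
    generalize hz : 1 - y * s * t * X = z at *
    field_simp
    subst hw hz
    ring

/-- `B` is obtained from `A` by the Bailey transform in base `p`, relative to the parameter `w / p`,
up to the index `m`; that is, `(A, B)` is a truncated Bailey pair. -/
def IsBaileyPair (p w : ℂ) (m : ℕ) (A B : ℕ → ℂ) : Prop :=
  ∀ k ≤ m, B k = ∑ r ∈ Finset.range (k + 1), A r / (qPoch p p (k - r) * qPoch w p (k + r))

/-- The finite Bailey lemma, in homogeneous form: the classical parameters are `ρ₁ = s / u`,
`ρ₂ = t / v`, so that `u = 0` or `v = 0` covers `ρ₁ → ∞` or `ρ₂ → ∞`. -/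
theorem IsBaileyPair.sum_eq {p : ℂ} (hp : ∀ k : ℕ, p ^ (k + 1) ≠ 1) {u v s t y : ℂ} {m : ℕ}
    {A B : ℕ → ℂ} (hAB : IsBaileyPair p (y * s * t) m A B)
    (h : qPoch (y * s * t) p (2 * m) ≠ 0) (hu : qPoch (y * t * u) p m ≠ 0)
    (hv : qPoch (y * s * v) p m ≠ 0) :
    ∑ k ∈ Finset.range (m + 1),
      qPochHom u s p k * qPochHom v t p k * y ^ k * B k *
        (qPoch (y * u * v) p (m - k) / qPoch p p (m - k)) =
    qPoch (y * t * u) p m * qPoch (y * s * v) p m *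
      ∑ r ∈ Finset.range (m + 1),
        qPochHom u s p r * qPochHom v t p r * y ^ r /
          (qPoch (y * t * u) p r * qPoch (y * s * v) p r) * A r /
            (qPoch p p (m - r) * qPoch (y * s * t) p (m + r)) := by
  have h1 : ∀ k ∈ Finset.range (m + 1),
      qPochHom u s p k * qPochHom v t p k * y ^ k * B k *
        (qPoch (y * u * v) p (m - k) / qPoch p p (m - k)) =
      ∑ r ∈ Finset.range (k + 1), qPochHom u s p k * qPochHom v t p k * y ^ k *
        (A r / (qPoch p p (k - r) * qPoch (y * s * t) p (k + r))) *
        (qPoch (y * u * v) p (m - k) / qPoch p p (m - k)) := by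
    intro k hk
    rw [hAB k (Nat.lt_succ_iff.1 (Finset.mem_range.1 hk)), Finset.mul_sum, Finset.sum_mul]
  rw [Finset.sum_congr rfl h1, Finset.mul_sum,
    Finset.sum_comm' (t' := Finset.range (m + 1)) (s' := fun r => Finset.Ico r (m + 1))
      (by intro x y; simp only [Finset.mem_range, Finset.mem_Ico]; omega)]
  refine Finset.sum_congr rfl fun r hr => ?_
  obtain ⟨M, rfl⟩ := Nat.exists_eq_add_of_le (Nat.lt_succ_iff.1 (Finset.mem_range.1 hr))
  rw [Finset.sum_Ico_eq_sum_range]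
  have e1 : y * (s * p ^ r) * (t * p ^ r) = y * s * t * p ^ (r + r) := by ring
  have e2 : y * (t * p ^ r) * u = y * t * u * p ^ r := by ring
  have e3 : y * (s * p ^ r) * v = y * s * v * p ^ r := by ring
  have h2 : qPoch (y * s * t * p ^ (r + r)) p M ≠ 0 :=
    qPoch_shift_ne_zero (qPoch_ne_zero_of_le h (by omega))
  have key := saalschutz hp u v (s * p ^ r) (t * p ^ r) y M (by rwa [e1])
  rw [e1, e2, e3] at key
  have e4 : r + M + 1 - r = M + 1 := by omega
  have e5 : r + M - r = M := by omega
  have e6 : r + M + r = r + r + M := by omega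
  have h3 : qPoch (y * s * t) p (r + r) ≠ 0 := qPoch_ne_zero_of_le h (by omega)
  rw [qPoch_add] at hu hv
  have hu1 := left_ne_zero_of_mul hu
  have hv1 := left_ne_zero_of_mul hv
  have h4 := qPoch_self_ne_zero hp M
  rw [e4, e5, e6, qPoch_add _ _ r M, qPoch_add _ _ r M, qPoch_add _ _ (r + r) M]
  have : qPoch (y * t * u) p r * qPoch (y * t * u * p ^ r) p M *
      (qPoch (y * s * v) p r * qPoch (y * s * v * p ^ r) p M) *
      (qPochHom u s p r * qPochHom v t p r * y ^ r / (qPoch (y * t * u) p r * qPoch (y * s * v) p r)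
        * A r / (qPoch p p M * (qPoch (y * s * t) p (r + r) *
          qPoch (y * s * t * p ^ (r + r)) p M))) =
      (qPochHom u s p r * qPochHom v t p r * y ^ r * A r / qPoch (y * s * t) p (r + r)) *
      (qPoch (y * t * u * p ^ r) p M * qPoch (y * s * v * p ^ r) p M /
        (qPoch p p M * qPoch (y * s * t * p ^ (r + r)) p M)) := by
    field_simp
  rw [this, ← key, Finset.mul_sum]
  refine Finset.sum_congr rfl fun j hj => ?_
  have hj' := Finset.mem_range.1 hj
  have e7 : r + j - r = j := by omega
  have e8 : r + M - (r + j) = M - j := by omega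
  have e9 : r + j + r = r + r + j := by omega
  have h5 : qPoch (y * s * t * p ^ (r + r)) p j ≠ 0 := qPoch_ne_zero_of_le h2 (by omega)
  have h6 := qPoch_self_ne_zero hp j
  have h7 := qPoch_self_ne_zero hp (M - j)
  rw [e7, e8, e9, qPochHom_add, qPochHom_add, qPoch_add _ _ (r + r) j, pow_add y]
  field_simp

/-! ### The very-well-poised ₆φ₅ sum -/

/-- The very-well-poised factor `(1 - A q^{2r}) (A; q)_r / (1 - A)`, written so that it also makes
sense at `A = 1`. -/
def vwpFactor (A q : ℂ) : ℕ → ℂ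
  | 0 => 1
  | r + 1 => (1 - A * q ^ (2 * (r + 1))) * qPoch (A * q) q r

lemma one_sub_mul_vwpFactor (A q : ℂ) (r : ℕ) :
    (1 - A) * vwpFactor A q r = (1 - A * q ^ (2 * r)) * qPoch A q r := by
  cases r with
  | zero => simp [vwpFactor, qPoch_zero]
  | succ r => rw [vwpFactor, qPoch_succ']; ring

/-- The sequence `A_r` of the unit Bailey pair; `qPochHom 0 1 q r = (-1)^r q^{r(r-1)/2}`. -/
def unitBailey (A q : ℂ) (r : ℕ) : ℂ := vwpFactor A q r * qPochHom 0 1 q r / qPoch q q r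

lemma unitBailey_partial_sum {q : ℂ} (hq : ∀ k : ℕ, q ^ (k + 1) ≠ 1) (A : ℂ) (R : ℕ) :
    ∀ e : ℕ, R + e ≠ 0 → qPoch (A * q) q (R + e + R) ≠ 0 →
    ∑ r ∈ Finset.range (R + 1),
      unitBailey A q r / (qPoch q q (R + e - r) * qPoch (A * q) q (R + e + r)) =
    qPochHom 0 1 q R * q ^ R * qPoch (A * q) q R * (1 - q ^ e) /
      (qPoch q q R * qPoch q q e * (1 - q ^ (R + e)) * qPoch (A * q) q (R + e + R)) := by
  induction R with
  | zero =>
    intro e he h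
    obtain ⟨e, rfl⟩ := Nat.exists_eq_succ_of_ne_zero (show e ≠ 0 by omega)
    simp only [zero_add, add_zero] at h
    have h1 : 1 - q ^ (e + 1) ≠ 0 := sub_ne_zero.2 (hq e).symm
    have h2 := qPoch_self_ne_zero hq (e + 1)
    simp only [Finset.sum_range_one, unitBailey, vwpFactor, qPochHom_zero, qPoch_zero, zero_add,
      Nat.sub_zero, add_zero, pow_zero, Nat.succ_eq_add_one]
    field_simp
  | succ R ih =>
    intro e he h
    have e1 : R + 1 + e = R + (e + 1) := by omega
    rw [e1] at h ⊢
    have e3 : R + (e + 1) - (R + 1) = e := by omega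
    have e4 : R + (e + 1) + (R + 1) = R + (e + 1) + R + 1 := by omega
    rw [e4, qPoch_succ] at h
    have h6 := left_ne_zero_of_mul h
    have h7 := right_ne_zero_of_mul h
    rw [Finset.sum_range_succ, ih (e + 1) (by omega) h6, e3, e4]
    have h1 := qPoch_self_ne_zero hq e
    have h2 : 1 - q * q ^ e ≠ 0 := by rw [← pow_succ']; exact sub_ne_zero.2 (hq e).symm
    have h3 := qPoch_self_ne_zero hq R
    have h4 : 1 - q * q ^ R ≠ 0 := by rw [← pow_succ']; exact sub_ne_zero.2 (hq R).symm
    have h5 : 1 - q ^ (R + (e + 1)) ≠ 0 := by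
      rw [← add_assoc]; exact sub_ne_zero.2 (hq (R + e)).symm
    clear h ih
    have e5 : q ^ (R + (e + 1) + R) = q ^ R * q ^ R * q ^ e * q := by ring
    have e6 : q ^ (R + (e + 1)) = q ^ R * q ^ e * q := by ring
    simp only [unitBailey, vwpFactor, qPochHom_succ, qPoch_succ, e5, e6, zero_sub, one_mul] at *
    rw [show q ^ (2 * (R + 1)) = q ^ R * q ^ R * q ^ 2 by ring, pow_succ' q R, pow_succ' q e]
    generalize qPochHom 0 1 q R = H1
    generalize qPoch (A * q) q (R + (e + 1) + R) = Z at *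
    generalize qPoch (A * q) q R = D at *
    generalize qPoch q q R = P1 at *
    generalize qPoch q q e = P2 at *
    generalize q ^ R = X at *
    generalize q ^ e = E at *
    generalize hw : 1 - q * E = w at *
    generalize hw' : 1 - q * X = w' at *
    generalize hz : 1 - A * q * (X * X * E * q) = z at *
    generalize hx : 1 - X * E * q = x at *
    field_simp
    subst hw hw' hz hx
    ring

theorem isBaileyPair_unit {q : ℂ} (hq : ∀ k : ℕ, q ^ (k + 1) ≠ 1) (A : ℂ) (m : ℕ)
    (h : qPoch (A * q) q (2 * m) ≠ 0) :
    IsBaileyPair q (A * q) m (unitBailey A q) (fun k => if k = 0 then 1 else 0) := by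
  intro k hk
  rcases Nat.eq_zero_or_pos k with rfl | hk0
  · simp [unitBailey, vwpFactor, qPochHom_zero, qPoch_zero]
  · have := unitBailey_partial_sum hq A k 0 (by omega) (qPoch_ne_zero_of_le h (by omega))
    simp only [add_zero] at this
    rw [this]
    simp [hk0.ne']

/-- The terminating very-well-poised `₆φ₅` sum: the finite Bailey lemma for the unit pair. -/
theorem six_phi_five {q : ℂ} (hq : ∀ k : ℕ, q ^ (k + 1) ≠ 1) {A u v s t y d e z : ℂ} {m : ℕ}
    (hA : y * s * t = A * q) (hd : y * t * u = d) (he : y * s * v = e) (hz : y * u * v = z)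
    (h : qPoch (A * q) q (2 * m) ≠ 0) (hu : qPoch d q m ≠ 0) (hv : qPoch e q m ≠ 0) :
    ∑ r ∈ Finset.range (m + 1),
        qPochHom u s q r * qPochHom v t q r * y ^ r / (qPoch d q r * qPoch e q r) *
          unitBailey A q r / (qPoch q q (m - r) * qPoch (A * q) q (m + r)) =
      qPoch z q m / (qPoch q q m * (qPoch d q m * qPoch e q m)) := by
  subst hd he hz
  have hAB := isBaileyPair_unit hq A m h
  rw [← hA] at hAB h ⊢
  have key := hAB.sum_eq hq h hu hv
  rw [Finset.sum_range_succ', Finset.sum_eq_zero (fun k _ => by simp)] at key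
  simp only [qPochHom_zero, pow_zero, if_true, Nat.sub_zero, zero_add, one_mul] at key
  rw [← div_div, key, mul_div_cancel_left₀ _ (mul_ne_zero hu hv)]

/-! ### The two Bailey pairs -/

lemma qPochHom_neg_pow_mul (q : ℂ) {N r : ℕ} (hr : r ≤ N) :
    qPochHom 0 1 q r * (-1) ^ r * qPochHom (-q ^ N) 1 q r * qPoch (-q) q (N - r) =
      qPochHom 0 1 (q ^ 2) r * qPoch (-q) q N := by
  induction r with
  | zero => simp [qPochHom_zero]
  | succ r ih =>
    have ih := ih (by omega)
    obtain ⟨e, rfl⟩ := Nat.exists_eq_add_of_le hr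
    have e1 : r + 1 + e - r = e + 1 := by omega
    have e2 : r + 1 + e - (r + 1) = e := by omega
    rw [e1, qPoch_succ] at ih
    rw [e2, qPochHom_succ, qPochHom_succ, qPochHom_succ]
    have e3 : q ^ (r + 1 + e) = q ^ r * q ^ e * q := by ring
    simp only [e3] at ih ⊢
    linear_combination (-(q ^ r) ^ 2) * ih

lemma qPoch_neg_self_ne_zero {q : ℂ} (hq1 : ‖q‖ < 1) (n : ℕ) : qPoch (-q) q n ≠ 0 := by
  have := qPoch_self_ne_zero (pow_succ_ne_one_of_norm_lt_one (norm_sq_lt_one hq1)) n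
  rw [qPoch_sq] at this
  exact right_ne_zero_of_mul this

/-- The sequence `A_r` of the Bailey pair in base `q²`, relative to `α²`, behind the second
transformation. -/
def secondA (α lam q : ℂ) (r : ℕ) : ℂ :=
  vwpFactor (-α) q r * qPochHom lam (α * q) q r * qPochHom 0 1 (q ^ 2) r /
    (qPoch q q r * qPoch (-lam) q r)

/-- The sequence `B_n` of the Bailey pair behind the second transformation. -/
def secondB (α lam q : ℂ) (n : ℕ) : ℂ :=
  qPoch lam q (2 * n) /
    (qPoch (α * q) q (2 * n) * qPoch (q ^ 2) (q ^ 2) n * qPoch (lam ^ 2) (q ^ 2) n)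

/-- The sequence `A_r` of the Bailey pair in base `q²`, relative to `α²`, behind the first
transformation. -/
def firstA (α lam q : ℂ) (r : ℕ) : ℂ :=
  (1 - α * q ^ (2 * r)) / (1 - α) * (vwpFactor (-α) q r * qPochHom lam α q r *
    qPochHom 0 1 (q ^ 2) r) / (qPoch q q r * qPoch (-(q * lam)) q r)

/-- The sequence `B_n` of the Bailey pair behind the first transformation. -/
def firstB (α lam q : ℂ) (n : ℕ) : ℂ :=
  qPoch lam q (2 * n) /
    (qPoch α q (2 * n) * qPoch (q ^ 2) (q ^ 2) n * qPoch (q ^ 2 * lam ^ 2) (q ^ 2) n)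

/-- In base `q`, the summands of the Bailey transform of `secondA` in base `q²` are those of a
very-well-poised `₆φ₅` series with `A = -α`. -/
lemma secondA_div {q : ℂ} (hq1 : ‖q‖ < 1) {α lam : ℂ} {N r : ℕ} (hr : r ≤ N)
    (h : qPoch (α ^ 2 * q ^ 2) (q ^ 2) (2 * N) ≠ 0) (hl : qPoch (-lam) q N ≠ 0) :
    secondA α lam q r / (qPoch (q ^ 2) (q ^ 2) (N - r) * qPoch (α ^ 2 * q ^ 2) (q ^ 2) (N + r)) =
      1 / (qPoch (-q) q N * qPoch (α * q) q N) *
        (qPochHom lam (α * q) q r * qPochHom (-q ^ N) 1 q r * (-1) ^ r /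
          (qPoch (-lam) q r * qPoch (α * q * q ^ N) q r) *
          unitBailey (-α) q r / (qPoch q q (N - r) * qPoch (-α * q) q (N + r))) := by
  have h0 := qPoch_neg_self_ne_zero hq1
  have h1 := qPoch_self_ne_zero (pow_succ_ne_one_of_norm_lt_one hq1)
  have e1 : α ^ 2 * q ^ 2 = (α * q) ^ 2 := by ring
  have h2 := qPoch_ne_zero_of_le h (show N + r ≤ 2 * N by omega)
  rw [e1, qPoch_sq] at h2
  have h3 := left_ne_zero_of_mul h2
  have h4 := right_ne_zero_of_mul h2
  rw [qPoch_add] at h3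
  have h5 := left_ne_zero_of_mul h3
  have h6 := right_ne_zero_of_mul h3
  have h7 := qPoch_ne_zero_of_le hl hr
  have h8 := h1 r
  have h9 := h1 (N - r)
  have h10 := h0 N
  have h11 := h0 (N - r)
  have key := qPochHom_neg_pow_mul q hr
  rw [e1, qPoch_sq, qPoch_sq, qPoch_add (α * q) q N r, secondA, unitBailey, neg_mul]
  field_simp
  linear_combination (-vwpFactor (-α) q r * qPochHom lam (α * q) q r) * key

theorem isBaileyPair_second {q : ℂ} (hq1 : ‖q‖ < 1) {α lam : ℂ} {m : ℕ}
    (h : qPoch (α ^ 2 * q ^ 2) (q ^ 2) (2 * m) ≠ 0) (hl : qPoch (lam ^ 2) (q ^ 2) m ≠ 0) :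
    IsBaileyPair (q ^ 2) (α ^ 2 * q ^ 2) m (secondA α lam q) (secondB α lam q) := by
  intro N hN
  have h := qPoch_ne_zero_of_le h (show 2 * N ≤ 2 * m by omega)
  have hl := qPoch_ne_zero_of_le hl hN
  rw [qPoch_sq] at hl
  have hl1 := left_ne_zero_of_mul hl
  have hl2 := right_ne_zero_of_mul hl
  rw [Finset.sum_congr rfl fun r hr =>
    secondA_div hq1 (Nat.lt_succ_iff.1 (Finset.mem_range.1 hr)) h hl2, ← Finset.mul_sum]
  have e1 : α ^ 2 * q ^ 2 = (α * q) ^ 2 := by ring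
  rw [e1, qPoch_sq] at h
  have h3 := left_ne_zero_of_mul h
  have h4 := right_ne_zero_of_mul h
  have h5 := h3
  rw [two_mul, qPoch_add] at h5
  have h6 := left_ne_zero_of_mul h5
  have h7 := right_ne_zero_of_mul h5
  rw [six_phi_five (pow_succ_ne_one_of_norm_lt_one hq1) (z := lam * q ^ N) (by ring) (by ring)
    (by ring) (by ring) (by rwa [neg_mul]) hl2 h7, secondB, two_mul, qPoch_add, qPoch_add,
    qPoch_sq q, qPoch_sq lam]
  have h8 := qPoch_neg_self_ne_zero hq1 N
  have h9 := qPoch_self_ne_zero (pow_succ_ne_one_of_norm_lt_one hq1) N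
  field_simp

/-- Multiplying the terms of the second pair by `q^{-r} - α q^r` turns it into the first one, because
`q^{N-r} (1 - α q^{2r}) = (1 - α q^{2N}) - (1 - q^{N-r}) (1 + α q^{N+r})` expresses the transform at
`N` by two `₆φ₅` sums of lengths `N` and `N - 1`. -/
theorem isBaileyPair_first {q : ℂ} (hq0 : q ≠ 0) (hq1 : ‖q‖ < 1) {α lam : ℂ} {m : ℕ}
    (hα : 1 - α ≠ 0)
    (h : qPoch (α ^ 2 * q ^ 2) (q ^ 2) (2 * m) ≠ 0) (hl : qPoch (q ^ 2 * lam ^ 2) (q ^ 2) m ≠ 0) :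
    IsBaileyPair (q ^ 2) (α ^ 2 * q ^ 2) m (firstA α lam q) (firstB α lam q) := by
  intro N hN
  have h := qPoch_ne_zero_of_le h (show 2 * N ≤ 2 * m by omega)
  have hl := qPoch_ne_zero_of_le hl hN
  rw [← mul_pow, qPoch_sq] at hl
  have hl1 := left_ne_zero_of_mul hl
  have hl2 := right_ne_zero_of_mul hl
  rcases N with _ | n
  · simp [firstA, firstB, vwpFactor, qPochHom_zero, qPoch_zero, hα]
  have hterm : ∀ r ∈ Finset.range (n + 1 + 1),
      firstA α lam q r / (qPoch (q ^ 2) (q ^ 2) (n + 1 - r) *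
        qPoch (α ^ 2 * q ^ 2) (q ^ 2) (n + 1 + r)) =
      1 / (q ^ (n + 1) * (1 - α)) * ((1 - α * q ^ (2 * (n + 1))) *
        (secondA α (q * lam) q r / (qPoch (q ^ 2) (q ^ 2) (n + 1 - r) *
          qPoch (α ^ 2 * q ^ 2) (q ^ 2) (n + 1 + r))) -
        (1 - q ^ (n + 1 - r)) * (1 + α * q ^ (n + 1 + r)) *
        (secondA α (q * lam) q r / (qPoch (q ^ 2) (q ^ 2) (n + 1 - r) *
          qPoch (α ^ 2 * q ^ 2) (q ^ 2) (n + 1 + r)))) := by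
    intro r hr
    obtain ⟨e, he⟩ := Nat.exists_eq_add_of_le (Nat.lt_succ_iff.1 (Finset.mem_range.1 hr))
    have hA : q ^ (n + 1) * (1 - α) * firstA α lam q r =
        q ^ e * (1 - α * q ^ (2 * r)) * secondA α (q * lam) q r := by
      rw [firstA, secondA, mul_comm α q, qPochHom_mul_left, he, pow_add]
      field_simp
    have e2 : n + 1 - r = e := by omega
    have hx : q ^ e * (1 - α * q ^ (2 * r)) =
        (1 - α * q ^ (2 * (n + 1))) - (1 - q ^ (n + 1 - r)) * (1 + α * q ^ (n + 1 + r)) := by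
      rw [e2, he]; ring
    rw [← sub_mul, ← hx, ← mul_div_assoc, ← hA]
    field_simp
  rw [Finset.sum_congr rfl hterm, ← Finset.mul_sum, Finset.sum_sub_distrib, ← Finset.mul_sum,
    ← isBaileyPair_second hq1 h (by rwa [qPoch_sq]) (n + 1) le_rfl,
    Finset.sum_range_succ _ (n + 1)]
  have hterm2 : ∀ r ∈ Finset.range (n + 1),
      (1 - q ^ (n + 1 - r)) * (1 + α * q ^ (n + 1 + r)) *
        (secondA α (q * lam) q r / (qPoch (q ^ 2) (q ^ 2) (n + 1 - r) *
          qPoch (α ^ 2 * q ^ 2) (q ^ 2) (n + 1 + r))) =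
      1 / (qPoch (-q) q (n + 1) * qPoch (α * q) q (n + 1)) *
        (qPochHom (q * lam) (α * q) q r * qPochHom (-q ^ (n + 1)) 1 q r * (-1) ^ r /
          (qPoch (-(q * lam)) q r * qPoch (α * q * q ^ (n + 1)) q r) *
          unitBailey (-α) q r / (qPoch q q (n - r) * qPoch (-α * q) q (n + r))) := by
    intro r hr
    have hr' := Nat.lt_succ_iff.1 (Finset.mem_range.1 hr)
    rw [secondA_div hq1 (by omega) h hl2]
    obtain ⟨e, rfl⟩ := Nat.exists_eq_add_of_le hr'
    have e1 : r + e + 1 - r = e + 1 := by omega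
    have e2 : r + e - r = e := by omega
    have e3 : r + e + 1 + r = r + e + r + 1 := by omega
    have h1 : 1 - q ^ (e + 1) ≠ 0 :=
      sub_ne_zero.2 (pow_succ_ne_one_of_norm_lt_one hq1 e).symm
    have h2 := qPoch_ne_zero_of_le h (show r + e + r + 1 ≤ _ by omega)
    rw [← mul_pow, qPoch_sq, qPoch_succ (-(α * q))] at h2
    have h3 := right_ne_zero_of_mul (right_ne_zero_of_mul h2)
    rw [e1, e2, e3, qPoch_succ q, qPoch_succ (-α * q)]
    have e4 : 1 - -α * q * q ^ (r + e + r) = 1 + α * q ^ (r + e + r + 1) := by ring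
    have e5 : 1 - -(α * q) * q ^ (r + e + r) = 1 + α * q ^ (r + e + r + 1) := by ring
    have e6 : 1 - q * q ^ e = 1 - q ^ (e + 1) := by ring
    rw [e5] at h3
    rw [e4, e6]
    generalize 1 - q ^ (e + 1) = w at *
    generalize 1 + α * q ^ (r + e + r + 1) = w' at *
    field_simp
  have h0 := h
  rw [← mul_pow, qPoch_sq] at h0
  have h3 := left_ne_zero_of_mul h0
  have h4 := right_ne_zero_of_mul h0
  rw [two_mul, qPoch_add] at h3
  have h6 := left_ne_zero_of_mul h3
  have h7 := right_ne_zero_of_mul h3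
  have hn := qPoch_ne_zero_of_le h7 (Nat.le_succ n)
  have hln := qPoch_ne_zero_of_le hl2 (Nat.le_succ n)
  rw [Finset.sum_congr rfl hterm2, ← Finset.mul_sum,
    six_phi_five (pow_succ_ne_one_of_norm_lt_one hq1) (z := q * lam * q ^ (n + 1)) (by ring)
      (by ring) (by ring) (by ring)
      (by rw [neg_mul]; exact qPoch_ne_zero_of_le h4 (by omega)) hln hn,
    Nat.sub_self, pow_zero, sub_self, zero_mul, zero_mul, add_zero, firstB, secondB]
  -- both sides contain the shifted factorials of `e7`-`e11`; what remains is the rational identity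
  -- `(1 - λ q^{2N}) - (1 - q^N) (1 + λ q^N) = q^N (1 - λ)` with `N = n + 1`
  have e7 : qPoch lam q (2 * (n + 1)) = (1 - lam) * (qPoch (q * lam) q (n + 1) *
      qPoch (q * lam * q ^ (n + 1)) q n) := by
    rw [show 2 * (n + 1) = (n + 1 + n) + 1 by ring, qPoch_succ', mul_comm lam q, qPoch_add]
  have e8 : qPoch (q * lam) q (2 * (n + 1)) = qPoch (q * lam) q (n + 1) *
      (qPoch (q * lam * q ^ (n + 1)) q n * (1 - lam * q ^ (2 * (n + 1)))) := by
    rw [two_mul, qPoch_add, qPoch_succ (q * lam * q ^ (n + 1))]; ring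
  have e9 : (1 - α) * qPoch (α * q) q (2 * (n + 1)) =
      qPoch α q (2 * (n + 1)) * (1 - α * q ^ (2 * (n + 1))) := by
    rw [← qPoch_succ', qPoch_succ]
  have e10 : qPoch (α * q) q (2 * (n + 1)) = qPoch (α * q) q (n + 1) *
      (qPoch (α * q * q ^ (n + 1)) q n * (1 - α * q ^ (2 * (n + 1)))) := by
    rw [two_mul, qPoch_add, qPoch_succ (α * q * q ^ (n + 1))]; ring
  have e11 : qPoch α q (2 * (n + 1)) = (1 - α) * (qPoch (α * q) q (n + 1) *
      qPoch (α * q * q ^ (n + 1)) q n) := by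
    rw [show 2 * (n + 1) = (n + 1 + n) + 1 by ring, qPoch_succ', qPoch_add]
  have h8 := qPoch_neg_self_ne_zero hq1 (n + 1)
  have h9 := qPoch_self_ne_zero (pow_succ_ne_one_of_norm_lt_one hq1) (n + 1)
  have h10 : 1 - α * q ^ (2 * (n + 1)) ≠ 0 := by
    rw [qPoch_succ] at h7
    convert right_ne_zero_of_mul h7 using 1; ring
  rw [qPoch_succ] at h9 hl2
  have h11 := left_ne_zero_of_mul h9
  have h12 := right_ne_zero_of_mul h9
  have h13 := right_ne_zero_of_mul hl2
  rw [e7, e8, e10, e11, ← mul_pow, qPoch_sq, qPoch_sq, qPoch_succ q q n,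
    qPoch_succ (-(q * lam)) q n]
  have e12 : q ^ (2 * (n + 1)) = q ^ 2 * (q ^ n * q ^ n) := by ring
  rw [e12] at h10 ⊢
  clear hterm hterm2 h h0 h3 h4 h7 e7 e8 e9 e10 e11 e12 hl hl2 h9
  simp only [pow_succ' q n] at *
  generalize qPoch (q * lam * (q * q ^ n)) q n = Z1 at *
  generalize qPoch (q * lam) q (n + 1) = Z2 at *
  generalize qPoch (α * q) q (n + 1) = Z3 at *
  generalize qPoch (α * q * (q * q ^ n)) q n = Z4 at *
  generalize qPoch (-(q * lam)) q n = Z5 at *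
  generalize qPoch (-q) q (n + 1) = Z6 at *
  generalize qPoch q q n = Z7 at *
  have hX : q ^ n ≠ 0 := pow_ne_zero _ hq0
  generalize q ^ n = X at *
  generalize hw : 1 - q * X = w at *
  generalize hw' : 1 - -(q * lam) * X = w' at *
  generalize hz : 1 - α * (q ^ 2 * (X * X)) = z at *
  field_simp
  subst hw hw' hz
  ring

/-! ### The finite Bailey lemma at exceptional parameters -/

lemma continuousAt_qPoch {f : ℂ → ℂ} {x : ℂ} (hf : ContinuousAt f x) (q : ℂ) (n : ℕ) :
    ContinuousAt (fun y => qPoch (f y) q n) x :=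
  tendsto_finsetProd _ fun _ _ => tendsto_const_nhds.sub (hf.mul continuousAt_const)

lemma continuousAt_qPochHom {f : ℂ → ℂ} {x : ℂ} (hf : ContinuousAt f x) (c q : ℂ) (n : ℕ) :
    ContinuousAt (fun y => qPochHom c (f y) q n) x :=
  tendsto_finsetProd _ fun _ _ => tendsto_const_nhds.sub (hf.mul continuousAt_const)

lemma continuousAt_vwpFactor {f : ℂ → ℂ} {x : ℂ} (hf : ContinuousAt f x) (q : ℂ) (n : ℕ) :
    ContinuousAt (fun y => vwpFactor (f y) q n) x := by
  cases n with
  | zero => exact continuousAt_const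
  | succ n =>
    exact (continuousAt_const.sub (hf.mul continuousAt_const)).mul
      (continuousAt_qPoch (hf.mul continuousAt_const) q n)

lemma eventually_qPoch_sq_ne_zero (α c p : ℂ) (n : ℕ) :
    ∀ᶠ x in 𝓝[≠] α, qPoch (x ^ 2 * c) p n ≠ 0 := by
  have h : ∀ k ∈ Finset.range n, ∀ᶠ x in 𝓝[≠] α, 1 - x ^ 2 * c * p ^ k ≠ 0 := by
    intro k _
    by_cases h0 : 1 - α ^ 2 * c * p ^ k = 0
    · have hα : α ≠ -α := by
        intro h
        have : α = 0 := by linear_combination h / 2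
        simp [this] at h0
      have h1 : ∀ᶠ x in 𝓝[≠] α, x ≠ -α :=
        (continuousAt_id.eventually_ne hα).filter_mono nhdsWithin_le_nhds
      filter_upwards [h1, self_mem_nhdsWithin] with x hx hx' h2
      have hc : c * p ^ k ≠ 0 := by
        intro hc
        rw [mul_assoc, hc] at h0
        simp at h0
      have h3 : (x - α) * (x + α) = 0 := by
        apply mul_right_cancel₀ hc
        linear_combination h0 - h2
      rcases mul_eq_zero.1 h3 with h3 | h3
      · exact hx' (sub_eq_zero.1 h3)
      · exact hx (eq_neg_of_add_eq_zero_left h3)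
    · have hc : ContinuousAt (fun x : ℂ => 1 - x ^ 2 * c * p ^ k) α := by fun_prop
      exact (hc.eventually_ne h0).filter_mono nhdsWithin_le_nhds
  filter_upwards [(Finset.eventually_all _).2 h] with x hx
  exact Finset.prod_ne_zero_iff.2 hx

/-- The finite Bailey lemma for a family of Bailey pairs relative to `x²`, at a point `α` where the
denominators `(α² p; p)_{2m}` of the pair itself may vanish: both sides are continuous at `α`. -/
theorem bailey_sum_eq_of_eventually {p : ℂ} (hp : ∀ k : ℕ, p ^ (k + 1) ≠ 1) {α u v : ℂ} {m : ℕ}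
    {A B : ℂ → ℕ → ℂ} (hA : ∀ r ≤ m, ContinuousAt (fun x => A x r) α)
    (hB : ∀ r ≤ m, ContinuousAt (fun x => B x r) α)
    (hAB : ∀ᶠ x in 𝓝[≠] α, qPoch (x ^ 2 * p) p (2 * m) ≠ 0 →
      IsBaileyPair p (x ^ 2 * p) m (A x) (B x))
    (hw : qPoch (α ^ 2 * p * p ^ m) p m ≠ 0) (hd : qPoch (α ^ 2 * p * u) p m ≠ 0)
    (he : qPoch (α ^ 2 * p * v) p m ≠ 0) :
    qPoch (α ^ 2 * p) p m * ∑ k ∈ Finset.range (m + 1),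
      qPochHom u 1 p k * qPochHom v 1 p k * (α ^ 2 * p) ^ k * B α k *
        (qPoch (α ^ 2 * p * u * v) p (m - k) / qPoch p p (m - k)) =
    qPoch (α ^ 2 * p * u) p m * qPoch (α ^ 2 * p * v) p m *
      ∑ r ∈ Finset.range (m + 1),
        qPochHom u 1 p r * qPochHom v 1 p r * (α ^ 2 * p) ^ r * A α r /
          (qPoch (α ^ 2 * p * u) p r * qPoch (α ^ 2 * p * v) p r *
            (qPoch p p (m - r) * qPoch (α ^ 2 * p * p ^ m) p r)) := by
  have hpn := qPoch_self_ne_zero hp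
  refine tendsto_nhds_unique_of_eventuallyEq (l := 𝓝[≠] α)
    (f := fun α : ℂ => qPoch (α ^ 2 * p) p m * ∑ k ∈ Finset.range (m + 1),
      qPochHom u 1 p k * qPochHom v 1 p k * (α ^ 2 * p) ^ k * B α k *
        (qPoch (α ^ 2 * p * u * v) p (m - k) / qPoch p p (m - k)))
    (g := fun α : ℂ => qPoch (α ^ 2 * p * u) p m * qPoch (α ^ 2 * p * v) p m *
      ∑ r ∈ Finset.range (m + 1),
        qPochHom u 1 p r * qPochHom v 1 p r * (α ^ 2 * p) ^ r * A α r /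
          (qPoch (α ^ 2 * p * u) p r * qPoch (α ^ 2 * p * v) p r *
            (qPoch p p (m - r) * qPoch (α ^ 2 * p * p ^ m) p r))) ?_ ?_ ?_
  · refine Tendsto.mono_left ?_ nhdsWithin_le_nhds
    refine Tendsto.mul (continuousAt_qPoch (by fun_prop) _ _) (tendsto_finsetSum _ fun k hk => ?_)
    have hk' := Nat.lt_succ_iff.1 (Finset.mem_range.1 hk)
    exact Tendsto.mul (Tendsto.mul (ContinuousAt.tendsto (by fun_prop)) (hB k hk'))
      ((continuousAt_qPoch (by fun_prop) _ _).tendsto.div_const _)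
  · refine Tendsto.mono_left ?_ nhdsWithin_le_nhds
    refine Tendsto.mul (Tendsto.mul (continuousAt_qPoch (by fun_prop) _ _)
      (continuousAt_qPoch (by fun_prop) _ _)) (tendsto_finsetSum _ fun k hk => ?_)
    have hk' := Nat.lt_succ_iff.1 (Finset.mem_range.1 hk)
    refine Tendsto.div (Tendsto.mul (ContinuousAt.tendsto (by fun_prop)) (hA k hk'))
      (Tendsto.mul (Tendsto.mul (continuousAt_qPoch (by fun_prop) _ _)
        (continuousAt_qPoch (by fun_prop) _ _))
        (Tendsto.mul tendsto_const_nhds (continuousAt_qPoch (by fun_prop) _ _))) ?_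
    exact mul_ne_zero (mul_ne_zero (qPoch_ne_zero_of_le hd hk') (qPoch_ne_zero_of_le he hk'))
      (mul_ne_zero (hpn _) (qPoch_ne_zero_of_le hw hk'))
  · have hd' : ∀ᶠ x in 𝓝[≠] α, qPoch (x ^ 2 * p * u) p m ≠ 0 := by
      simp only [mul_assoc]
      exact eventually_qPoch_sq_ne_zero _ _ _ _
    have he' : ∀ᶠ x in 𝓝[≠] α, qPoch (x ^ 2 * p * v) p m ≠ 0 := by
      simp only [mul_assoc]
      exact eventually_qPoch_sq_ne_zero _ _ _ _
    filter_upwards [hAB, eventually_qPoch_sq_ne_zero α p p (2 * m), hd', he'] with x hx hx0 hd' he'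
    have hpair := hx hx0
    have e1 : x ^ 2 * p * 1 * 1 = x ^ 2 * p := by ring
    have key := IsBaileyPair.sum_eq hp (s := 1) (t := 1) (y := x ^ 2 * p) (u := u) (v := v)
      (by rwa [e1]) (by rwa [e1]) (by rwa [mul_one]) (by rwa [mul_one])
    simp only [mul_one] at key
    rw [key, mul_left_comm, Finset.mul_sum]
    congr 1
    refine Finset.sum_congr rfl fun r hr => ?_
    have hr' := Nat.lt_succ_iff.1 (Finset.mem_range.1 hr)
    rw [qPoch_add]
    have h1 := qPoch_ne_zero_of_le hx0 (show m + r ≤ 2 * m by omega)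
    rw [qPoch_add] at h1
    have h2 := left_ne_zero_of_mul h1
    have h3 := right_ne_zero_of_mul h1
    have h4 := qPoch_ne_zero_of_le hd' hr'
    have h5 := qPoch_ne_zero_of_le he' hr'
    have h6 := hpn (m - r)
    field_simp

lemma continuousAt_secondA (α lam q : ℂ) (n : ℕ) :
    ContinuousAt (fun x => secondA x lam q n) α := by
  refine ContinuousAt.div_const (ContinuousAt.mul (ContinuousAt.mul ?_ ?_) continuousAt_const) _
  · exact continuousAt_vwpFactor (by fun_prop) _ _
  · exact continuousAt_qPochHom (by fun_prop) _ _ _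

lemma continuousAt_firstA {α : ℂ} (hα : 1 - α ≠ 0) (lam q : ℂ) (n : ℕ) :
    ContinuousAt (fun x => firstA x lam q n) α := by
  refine ContinuousAt.div_const (ContinuousAt.mul (ContinuousAt.div (by fun_prop) (by fun_prop) hα)
    (ContinuousAt.mul (ContinuousAt.mul ?_ ?_) continuousAt_const)) _
  · exact continuousAt_vwpFactor (by fun_prop) _ _
  · exact continuousAt_qPochHom (by fun_prop) _ _ _

/-- The finite Bailey lemma for the first pair. -/
theorem first_finite {q : ℂ} (hq0 : q ≠ 0) (hq1 : ‖q‖ < 1) {α lam u v : ℂ} {m : ℕ}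
    (hα : 1 - α ≠ 0) (hα2 : qPoch α q (2 * m) ≠ 0)
    (hl : qPoch (q ^ 2 * lam ^ 2) (q ^ 2) m ≠ 0)
    (hw : qPoch (α ^ 2 * q ^ 2 * (q ^ 2) ^ m) (q ^ 2) m ≠ 0)
    (hd : qPoch (α ^ 2 * q ^ 2 * u) (q ^ 2) m ≠ 0)
    (he : qPoch (α ^ 2 * q ^ 2 * v) (q ^ 2) m ≠ 0) :
    qPoch (α ^ 2 * q ^ 2) (q ^ 2) m * ∑ k ∈ Finset.range (m + 1),
      qPochHom u 1 (q ^ 2) k * qPochHom v 1 (q ^ 2) k * (α ^ 2 * q ^ 2) ^ k * firstB α lam q k *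
        (qPoch (α ^ 2 * q ^ 2 * u * v) (q ^ 2) (m - k) / qPoch (q ^ 2) (q ^ 2) (m - k)) =
    qPoch (α ^ 2 * q ^ 2 * u) (q ^ 2) m * qPoch (α ^ 2 * q ^ 2 * v) (q ^ 2) m *
      ∑ r ∈ Finset.range (m + 1),
        qPochHom u 1 (q ^ 2) r * qPochHom v 1 (q ^ 2) r * (α ^ 2 * q ^ 2) ^ r * firstA α lam q r /
          (qPoch (α ^ 2 * q ^ 2 * u) (q ^ 2) r * qPoch (α ^ 2 * q ^ 2 * v) (q ^ 2) r *
            (qPoch (q ^ 2) (q ^ 2) (m - r) * qPoch (α ^ 2 * q ^ 2 * (q ^ 2) ^ m) (q ^ 2) r)) := by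
  have hp := pow_succ_ne_one_of_norm_lt_one (norm_sq_lt_one hq1)
  refine bailey_sum_eq_of_eventually hp (A := fun α => firstA α lam q)
    (B := fun α => firstB α lam q) (fun r _ => continuousAt_firstA hα lam q r) ?_ ?_ hw hd he
  · intro r hr
    refine ContinuousAt.div continuousAt_const (((continuousAt_qPoch (by fun_prop) _ _).mul
      continuousAt_const).mul continuousAt_const) ?_
    exact mul_ne_zero (mul_ne_zero (qPoch_ne_zero_of_le hα2 (by omega)) (qPoch_self_ne_zero hp r))
      (qPoch_ne_zero_of_le hl hr)
  · have h1 : ∀ᶠ x in 𝓝[≠] α, 1 - x ≠ 0 :=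
      (ContinuousAt.eventually_ne (by fun_prop) hα).filter_mono nhdsWithin_le_nhds
    filter_upwards [h1] with x hx h
    exact isBaileyPair_first hq0 hq1 hx h hl

/-- The finite Bailey lemma for the second pair. -/
theorem second_finite {q : ℂ} (hq1 : ‖q‖ < 1) {α lam u v : ℂ} {m : ℕ}
    (hα2 : qPoch (α * q) q (2 * m) ≠ 0)
    (hl : qPoch (lam ^ 2) (q ^ 2) m ≠ 0)
    (hw : qPoch (α ^ 2 * q ^ 2 * (q ^ 2) ^ m) (q ^ 2) m ≠ 0)
    (hd : qPoch (α ^ 2 * q ^ 2 * u) (q ^ 2) m ≠ 0)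
    (he : qPoch (α ^ 2 * q ^ 2 * v) (q ^ 2) m ≠ 0) :
    qPoch (α ^ 2 * q ^ 2) (q ^ 2) m * ∑ k ∈ Finset.range (m + 1),
      qPochHom u 1 (q ^ 2) k * qPochHom v 1 (q ^ 2) k * (α ^ 2 * q ^ 2) ^ k * secondB α lam q k *
        (qPoch (α ^ 2 * q ^ 2 * u * v) (q ^ 2) (m - k) / qPoch (q ^ 2) (q ^ 2) (m - k)) =
    qPoch (α ^ 2 * q ^ 2 * u) (q ^ 2) m * qPoch (α ^ 2 * q ^ 2 * v) (q ^ 2) m *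
      ∑ r ∈ Finset.range (m + 1),
        qPochHom u 1 (q ^ 2) r * qPochHom v 1 (q ^ 2) r * (α ^ 2 * q ^ 2) ^ r * secondA α lam q r /
          (qPoch (α ^ 2 * q ^ 2 * u) (q ^ 2) r * qPoch (α ^ 2 * q ^ 2 * v) (q ^ 2) r *
            (qPoch (q ^ 2) (q ^ 2) (m - r) * qPoch (α ^ 2 * q ^ 2 * (q ^ 2) ^ m) (q ^ 2) r)) := by
  have hp := pow_succ_ne_one_of_norm_lt_one (norm_sq_lt_one hq1)
  refine bailey_sum_eq_of_eventually hp (A := fun α => secondA α lam q)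
    (B := fun α => secondB α lam q) (fun r _ => continuousAt_secondA α lam q r) ?_ ?_ hw hd he
  · intro r hr
    refine ContinuousAt.div continuousAt_const (((continuousAt_qPoch (by fun_prop) _ _).mul
      continuousAt_const).mul continuousAt_const) ?_
    exact mul_ne_zero (mul_ne_zero (qPoch_ne_zero_of_le hα2 (by omega)) (qPoch_self_ne_zero hp r))
      (qPoch_ne_zero_of_le hl hr)
  · exact Eventually.of_forall fun x h => isBaileyPair_second hq1 h hl

/-! ### The terminating transformations -/

lemma qPochHom_eq_pow_mul {x : ℂ} (hx : x ≠ 0) (y q : ℂ) (n : ℕ) :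
    qPochHom x y q n = x ^ n * qPoch (y / x) q n := by
  induction n with
  | zero => simp [qPochHom_zero, qPoch_zero]
  | succ n ih => rw [qPochHom_succ, qPoch_succ, ih]; field_simp; ring

lemma firstA_eq {q : ℂ} (hq1 : ‖q‖ < 1) {α lam : ℂ} (hα : 1 - α ^ 2 ≠ 0) (hlam : lam ≠ 0) {n : ℕ}
    (h : qPoch α q n ≠ 0) :
    firstA α lam q n = (1 - α ^ 2 * q ^ (4 * n)) * qPoch (α ^ 2) (q ^ 2) n * qPoch (-q) q n *
      qPoch (α / lam) q n * lam ^ n * qPochHom 0 1 (q ^ 2) n /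
        ((1 - α ^ 2) * qPoch (q ^ 2) (q ^ 2) n * qPoch α q n * qPoch (-q * lam) q n) := by
  have h1 := one_sub_mul_vwpFactor (-α) q n
  have e1 : 1 - α ^ 2 = (1 - α) * (1 - -α) := by ring
  have e2 : 1 - α ^ 2 * q ^ (4 * n) = (1 - α * q ^ (2 * n)) * (1 - -α * q ^ (2 * n)) := by ring
  rw [e1] at hα
  have h2 := left_ne_zero_of_mul hα
  have h3 := right_ne_zero_of_mul hα
  have h4 := qPoch_neg_self_ne_zero hq1 n
  have h5 := qPoch_self_ne_zero (pow_succ_ne_one_of_norm_lt_one hq1) n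
  rw [e1, e2, qPoch_sq, qPoch_sq, firstA, qPochHom_eq_pow_mul hlam, neg_mul,
    eq_div_of_mul_eq h3 ((mul_comm _ _).trans h1)]
  generalize 1 - -α = w at *
  generalize 1 - α = w' at *
  rw [← sub_eq_zero]
  field_simp
  ring

lemma secondA_eq {q : ℂ} (hq1 : ‖q‖ < 1) {α lam : ℂ} (hα : 1 + α ≠ 0) (hlam : lam ≠ 0) {n : ℕ}
    (h : qPoch α q n ≠ 0) :
    secondA α lam q n = (1 + α * q ^ (2 * n)) * qPoch (α ^ 2) (q ^ 2) n * qPoch (-q) q n *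
      qPoch (q * α / lam) q n * lam ^ n * qPochHom 0 1 (q ^ 2) n /
        ((1 + α) * qPoch (q ^ 2) (q ^ 2) n * qPoch α q n * qPoch (-lam) q n) := by
  have h1 := one_sub_mul_vwpFactor (-α) q n
  have e1 : 1 - -α = 1 + α := by ring
  have e2 : 1 - -α * q ^ (2 * n) = 1 + α * q ^ (2 * n) := by ring
  rw [e1, e2] at h1
  have h4 := qPoch_neg_self_ne_zero hq1 n
  have h5 := qPoch_self_ne_zero (pow_succ_ne_one_of_norm_lt_one hq1) n
  rw [qPoch_sq, qPoch_sq, secondA, qPochHom_eq_pow_mul hlam, mul_comm α q,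
    eq_div_of_mul_eq hα ((mul_comm _ _).trans h1)]
  generalize 1 + α = w at *
  rw [← sub_eq_zero]
  field_simp
  ring

/-- Reversal of the `q`-shifted factorials: `c = p^{1-m} / z` and `c' = p^{-m}`. -/
lemma qPoch_reversal {p : ℂ} (hp0 : p ≠ 0) {z c c' : ℂ} {m : ℕ} (hc : c * z * p ^ m = p)
    (hc' : c' * p ^ m = 1) {k : ℕ} (hk : k ≤ m) :
    qPoch z p m * qPoch c' p k * p ^ k * qPoch p p (m - k) =
      z ^ k * qPoch z p (m - k) * qPoch p p m * qPoch c p k := by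
  induction k with
  | zero => simp [qPoch_zero]
  | succ k ih =>
    have ih := ih (by omega)
    obtain ⟨e, rfl⟩ := Nat.exists_eq_add_of_le hk
    have e1 : k + 1 + e - k = e + 1 := by omega
    have e2 : k + 1 + e - (k + 1) = e := by omega
    rw [e1, qPoch_succ z p e, qPoch_succ p p e] at ih
    rw [e2, qPoch_succ c, qPoch_succ c']
    have e3 : p ^ (k + 1 + e) = p ^ k * p ^ e * p := by ring
    rw [e3] at hc hc'
    have hc2 : c * z * (p ^ k * p ^ e) = 1 := by
      apply mul_right_cancel₀ hp0
      linear_combination hc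
    apply mul_right_cancel₀ (pow_ne_zero e hp0)
    generalize qPoch z p (k + 1 + e) = Z1 at *
    generalize qPoch p p (k + 1 + e) = Z2 at *
    linear_combination (-1) * ih - Z1 * qPoch c' p k * p ^ k * qPoch p p e * hc' +
      z ^ k * qPoch z p e * Z2 * qPoch c p k * hc2

lemma qPoch_inv_pow_mul {p : ℂ} {c : ℂ} {m : ℕ} (hc : c * p ^ m = 1) {k : ℕ} (hk : k ≤ m) :
    qPoch c p k * (p ^ m) ^ k * qPoch p p (m - k) = qPochHom 0 1 p k * qPoch p p m := by
  induction k with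
  | zero => simp [qPoch_zero, qPochHom_zero]
  | succ k ih =>
    have ih := ih (by omega)
    obtain ⟨e, rfl⟩ := Nat.exists_eq_add_of_le hk
    have e1 : k + 1 + e - k = e + 1 := by omega
    have e2 : k + 1 + e - (k + 1) = e := by omega
    rw [e1, qPoch_succ p p e] at ih
    rw [e2, qPoch_succ c, qPochHom_succ]
    have e3 : p ^ (k + 1 + e) = p ^ k * p ^ e * p := by ring
    rw [pow_succ _ k]
    generalize qPoch p p (k + 1 + e) = Z at *
    have e4 : (1 - c * p ^ k) * p ^ (k + 1 + e) = -p ^ k * (1 - p * p ^ e) := by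
      linear_combination (-p ^ k) * hc + e3
    linear_combination (-p ^ k) * ih + qPoch c p k * (p ^ (k + 1 + e)) ^ k * qPoch p p e * e4

lemma qPoch_eq_zero_of_lt {p c : ℂ} {m k : ℕ} (hc : c * p ^ m = 1) (hk : m < k) :
    qPoch c p k = 0 :=
  Finset.prod_eq_zero (Finset.mem_range.2 hk) (by rw [hc, sub_self])

/-- Reversing the factorials with the parameters `q^{-2m}` and `c = q⁴ / (α² a b q^{2m})` turns the
terms of the terminating `₅φ₄` series into those of the finite Bailey lemma. -/
lemma mul_phiTerm_terminating {q : ℂ} (hq0 : q ≠ 0) (hq1 : ‖q‖ < 1) {α a b l₁ l₂ d₁ d₂ d₃ c : ℂ}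
    {m k : ℕ} (ha : a ≠ 0) (hb : b ≠ 0)
    (hc : c * (α ^ 2 * a * b / q ^ 2) * (q ^ 2) ^ m = q ^ 2) (hk : k ≤ m)
    (hcm : qPoch c (q ^ 2) m ≠ 0) :
    qPoch (α ^ 2 * a * b / q ^ 2) (q ^ 2) m *
      phiTerm [q ^ (-2 * (m : ℤ)), q ^ 2 / a, q ^ 2 / b, l₁, l₂] [d₁, d₂, d₃, c]
        (q ^ 2) (q ^ 2) k =
    qPoch (q ^ 2) (q ^ 2) m * (qPochHom (a / q ^ 2) 1 (q ^ 2) k * qPochHom (b / q ^ 2) 1 (q ^ 2) k *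
      (α ^ 2 * q ^ 2) ^ k * (qPochs [l₁, l₂] (q ^ 2) k / qPochs [d₁, d₂, q ^ 2, d₃] (q ^ 2) k) *
        (qPoch (α ^ 2 * a * b / q ^ 2) (q ^ 2) (m - k) / qPoch (q ^ 2) (q ^ 2) (m - k))) := by
  have hp0 : q ^ 2 ≠ 0 := pow_ne_zero 2 hq0
  have hc' : q ^ (-2 * (m : ℤ)) * (q ^ 2) ^ m = 1 := by
    rw [← pow_mul, ← zpow_natCast, ← zpow_add₀ hq0]
    simp
  have key := qPoch_reversal hp0 hc hc' hk
  have h1 := qPoch_self_ne_zero (pow_succ_ne_one_of_norm_lt_one (norm_sq_lt_one hq1)) (m - k)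
  have h2 := qPoch_ne_zero_of_le hcm hk
  rw [qPochHom_eq_pow_mul (div_ne_zero ha hp0), qPochHom_eq_pow_mul (div_ne_zero hb hp0),
    one_div_div, one_div_div]
  generalize q ^ (-2 * (m : ℤ)) = c' at *
  simp only [phiTerm, qPochs, List.map, List.prod_cons, List.prod_nil, mul_one, List.length]
  norm_num
  have e1 : (a / q ^ 2) ^ k * (b / q ^ 2) ^ k * (α ^ 2 * q ^ 2) ^ k =
      (α ^ 2 * a * b / q ^ 2) ^ k := by
    rw [← mul_pow, ← mul_pow]; congr 1; field_simp
  have e2 : (q ^ 2) ^ k * qPoch c' (q ^ 2) k *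
      qPoch (α ^ 2 * a * b / q ^ 2) (q ^ 2) m / qPoch c (q ^ 2) k =
      (α ^ 2 * a * b / q ^ 2) ^ k * qPoch (q ^ 2) (q ^ 2) m *
        (qPoch (α ^ 2 * a * b / q ^ 2) (q ^ 2) (m - k) / qPoch (q ^ 2) (q ^ 2) (m - k)) := by
    field_simp
    linear_combination key
  generalize qPoch (α ^ 2 * a * b / q ^ 2) (q ^ 2) (m - k) / qPoch (q ^ 2) (q ^ 2) (m - k) = Z at *
  linear_combination
    (qPoch (q ^ 2 / a) (q ^ 2) k * qPoch (q ^ 2 / b) (q ^ 2) k * qPoch l₁ (q ^ 2) k *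
      qPoch l₂ (q ^ 2) k / (qPoch (q ^ 2) (q ^ 2) k * qPoch d₁ (q ^ 2) k * qPoch d₂ (q ^ 2) k *
        qPoch d₃ (q ^ 2) k)) * e2 -
    (qPoch (q ^ 2 / a) (q ^ 2) k * qPoch (q ^ 2 / b) (q ^ 2) k * qPoch l₁ (q ^ 2) k *
      qPoch l₂ (q ^ 2) k / (qPoch (q ^ 2) (q ^ 2) k * qPoch d₁ (q ^ 2) k * qPoch d₂ (q ^ 2) k *
        qPoch d₃ (q ^ 2) k)) * qPoch (q ^ 2) (q ^ 2) m * Z * e1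

/-- The common part of both terminating transformations: the finite Bailey lemma, rewritten in terms
of the parameters `a = q² u`, `b = q² v`. -/
lemma phi_terminating_eq {q : ℂ} (hq0 : q ≠ 0) (hq1 : ‖q‖ < 1) {α a b l₁ l₂ d₁ d₂ d₃ c : ℂ}
    {m : ℕ} {A B T : ℕ → ℂ} (ha : a ≠ 0) (hb : b ≠ 0)
    (hc : c * (α ^ 2 * a * b / q ^ 2) * (q ^ 2) ^ m = q ^ 2)
    (hcm : qPoch c (q ^ 2) m ≠ 0)
    (hd : qPoch (α ^ 2 * a) (q ^ 2) m ≠ 0) (he : qPoch (α ^ 2 * b) (q ^ 2) m ≠ 0)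
    (hB : ∀ k, B k = qPochs [l₁, l₂] (q ^ 2) k / qPochs [d₁, d₂, q ^ 2, d₃] (q ^ 2) k)
    (hT : ∀ n ≤ m, T n = qPoch (q ^ (-2 * (m : ℤ))) (q ^ 2) n * (q ^ (2 * m)) ^ n *
      (qPoch (q ^ 2 / a) (q ^ 2) n * (a / q ^ 2) ^ n *
      (qPoch (q ^ 2 / b) (q ^ 2) n * (b / q ^ 2) ^ n)) * (α ^ 2 * q ^ 2) ^ n *
        (A n / qPochHom 0 1 (q ^ 2) n) /
        (qPoch (α ^ 2 * a) (q ^ 2) n * qPoch (α ^ 2 * b) (q ^ 2) n *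
          qPoch (α ^ 2 * q ^ (2 * m + 2)) (q ^ 2) n))
    (key : qPoch (α ^ 2 * q ^ 2) (q ^ 2) m * ∑ k ∈ Finset.range (m + 1),
      qPochHom (a / q ^ 2) 1 (q ^ 2) k * qPochHom (b / q ^ 2) 1 (q ^ 2) k *
        (α ^ 2 * q ^ 2) ^ k * B k *
        (qPoch (α ^ 2 * q ^ 2 * (a / q ^ 2) * (b / q ^ 2)) (q ^ 2) (m - k) /
          qPoch (q ^ 2) (q ^ 2) (m - k)) =
    qPoch (α ^ 2 * q ^ 2 * (a / q ^ 2)) (q ^ 2) m * qPoch (α ^ 2 * q ^ 2 * (b / q ^ 2)) (q ^ 2) m *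
      ∑ r ∈ Finset.range (m + 1),
        qPochHom (a / q ^ 2) 1 (q ^ 2) r * qPochHom (b / q ^ 2) 1 (q ^ 2) r *
          (α ^ 2 * q ^ 2) ^ r * A r /
          (qPoch (α ^ 2 * q ^ 2 * (a / q ^ 2)) (q ^ 2) r *
            qPoch (α ^ 2 * q ^ 2 * (b / q ^ 2)) (q ^ 2) r *
            (qPoch (q ^ 2) (q ^ 2) (m - r) *
              qPoch (α ^ 2 * q ^ 2 * (q ^ 2) ^ m) (q ^ 2) r))) :
    qPochs [α ^ 2 * q ^ 2, α ^ 2 * a * b / q ^ 2] (q ^ 2) m /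
          qPochs [α ^ 2 * a, α ^ 2 * b] (q ^ 2) m *
        phi [q ^ (-2 * (m : ℤ)), q ^ 2 / a, q ^ 2 / b, l₁, l₂] [d₁, d₂, d₃, c] (q ^ 2) (q ^ 2) =
      ∑ n ∈ Finset.range (m + 1), T n := by
  have hp0 : q ^ 2 ≠ 0 := pow_ne_zero 2 hq0
  have hc' : q ^ (-2 * (m : ℤ)) * (q ^ 2) ^ m = 1 := by
    rw [← pow_mul, ← zpow_natCast, ← zpow_add₀ hq0]
    simp
  have e1 : α ^ 2 * q ^ 2 * (a / q ^ 2) = α ^ 2 * a := by field_simp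
  have e2 : α ^ 2 * q ^ 2 * (b / q ^ 2) = α ^ 2 * b := by field_simp
  have e3 : α ^ 2 * a * (b / q ^ 2) = α ^ 2 * a * b / q ^ 2 := by ring
  have e4 : α ^ 2 * q ^ 2 * (q ^ 2) ^ m = α ^ 2 * q ^ (2 * m + 2) := by ring
  rw [e1, e2, e3, e4] at key
  have hphi : qPoch (α ^ 2 * a * b / q ^ 2) (q ^ 2) m *
      phi [q ^ (-2 * (m : ℤ)), q ^ 2 / a, q ^ 2 / b, l₁, l₂] [d₁, d₂, d₃, c] (q ^ 2) (q ^ 2) =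
      qPoch (q ^ 2) (q ^ 2) m * ∑ k ∈ Finset.range (m + 1),
      qPochHom (a / q ^ 2) 1 (q ^ 2) k * qPochHom (b / q ^ 2) 1 (q ^ 2) k *
        (α ^ 2 * q ^ 2) ^ k * B k *
        (qPoch (α ^ 2 * a * b / q ^ 2) (q ^ 2) (m - k) / qPoch (q ^ 2) (q ^ 2) (m - k)) := by
    rw [phi, tsum_eq_sum (s := Finset.range (m + 1)), Finset.mul_sum, Finset.mul_sum]
    · refine Finset.sum_congr rfl fun k hk => ?_
      rw [mul_phiTerm_terminating hq0 hq1 ha hb hc (Nat.lt_succ_iff.1 (Finset.mem_range.1 hk)) hcm,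
        hB]
    · intro k hk
      have hk' : m < k := by simpa [Nat.lt_succ_iff] using hk
      simp [phiTerm, qPochs, qPoch_eq_zero_of_lt hc' hk', -neg_mul]
  have hpn := qPoch_self_ne_zero (pow_succ_ne_one_of_norm_lt_one (norm_sq_lt_one hq1))
  have hT' : ∑ n ∈ Finset.range (m + 1), T n = qPoch (q ^ 2) (q ^ 2) m *
      ∑ r ∈ Finset.range (m + 1),
        qPochHom (a / q ^ 2) 1 (q ^ 2) r * qPochHom (b / q ^ 2) 1 (q ^ 2) r *
          (α ^ 2 * q ^ 2) ^ r * A r /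
          (qPoch (α ^ 2 * a) (q ^ 2) r * qPoch (α ^ 2 * b) (q ^ 2) r *
            (qPoch (q ^ 2) (q ^ 2) (m - r) * qPoch (α ^ 2 * q ^ (2 * m + 2)) (q ^ 2) r)) := by
    rw [Finset.mul_sum]
    refine Finset.sum_congr rfl fun n hn => ?_
    have hn' := Nat.lt_succ_iff.1 (Finset.mem_range.1 hn)
    have h0 : qPochHom 0 1 (q ^ 2) n ≠ 0 :=
      Finset.prod_ne_zero_iff.2 fun k _ => by simp [hq0]
    have h1 := hpn (m - n)
    have hinv := qPoch_inv_pow_mul hc' hn'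
    rw [← pow_mul q 2 m] at hinv
    rw [hT n hn', qPochHom_eq_pow_mul (div_ne_zero ha hp0),
      qPochHom_eq_pow_mul (div_ne_zero hb hp0), one_div_div, one_div_div]
    rw [eq_div_of_mul_eq h1 hinv]
    field_simp
  simp only [qPochs, List.map, List.prod_cons, List.prod_nil, mul_one]
  rw [hT', div_mul_eq_mul_div, mul_assoc, hphi, mul_left_comm, key]
  field_simp

/-- The terminating first transformation. -/
theorem first_terminating {q : ℂ} (hq0 : q ≠ 0) (hq1 : ‖q‖ < 1) (m : ℕ) (α lam a b : ℂ)
    (hα : α ≠ 0) (hlam : lam ≠ 0) (ha : a ≠ 0) (hb : b ≠ 0) (hα2 : 1 - α ^ 2 ≠ 0)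
    (hde : qPochs [α ^ 2 * a, α ^ 2 * b] (q ^ 2) m ≠ 0)
    (hden : qPochs [α, q * α, q ^ 2 * lam ^ 2, q ^ 4 / (α ^ 2 * a * b * q ^ (2 * m))] (q ^ 2) m ≠ 0)
    (hw : qPoch (α ^ 2 * q ^ (2 * m + 2)) (q ^ 2) m ≠ 0) :
    qPochs [α ^ 2 * q ^ 2, α ^ 2 * a * b / q ^ 2] (q ^ 2) m /
          qPochs [α ^ 2 * a, α ^ 2 * b] (q ^ 2) m *
        phi [q ^ (-2 * (m : ℤ)), q ^ 2 / a, q ^ 2 / b, lam, q * lam]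
          [α, q * α, q ^ 2 * lam ^ 2, q ^ 4 / (α ^ 2 * a * b * q ^ (2 * m))]
          (q ^ 2) (q ^ 2) =
      ∑ n ∈ Finset.range (m + 1),
        (1 - α ^ 2 * q ^ (4 * n)) *
            qPochs [q ^ (-2 * (m : ℤ)), α ^ 2, q ^ 2 / a, q ^ 2 / b] (q ^ 2) n *
            qPochs [-q, α / lam] q n *
            (α ^ 2 * lam * a * b * q ^ (2 * (m : ℤ) - 2)) ^ n /
          ((1 - α ^ 2) *
            qPochs [q ^ 2, α ^ 2 * q ^ (2 * m + 2), α ^ 2 * a, α ^ 2 * b] (q ^ 2) n *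
            qPochs [α, -q * lam] q n) := by
  have hp0 : q ^ 2 ≠ 0 := pow_ne_zero 2 hq0
  simp only [qPochs, List.map, List.prod_cons, List.prod_nil, mul_one, mul_ne_zero_iff] at hde hden
  obtain ⟨hd, he⟩ := hde
  obtain ⟨h1, h2, h3, h4⟩ := hden
  have hαm : qPoch α q (2 * m) ≠ 0 := by rw [qPoch_two_mul]; exact mul_ne_zero h1 h2
  have e0 : 1 - α ^ 2 = (1 - α) * (1 + α) := by ring
  refine phi_terminating_eq hq0 hq1 (A := firstA α lam q) (B := firstB α lam q) ha hb ?_ h4 hd he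
    ?_ ?_ (first_finite hq0 hq1 (left_ne_zero_of_mul (e0 ▸ hα2)) hαm h3 ?_ ?_ ?_)
  · rw [← pow_mul]; field_simp
  · intro k
    simp only [firstB, qPochs, List.map, List.prod_cons, List.prod_nil, mul_one, qPoch_two_mul,
      mul_assoc]
  · intro n hn
    have h0 : qPochHom 0 1 (q ^ 2) n ≠ 0 :=
      Finset.prod_ne_zero_iff.2 fun k _ => by simp [hq0]
    rw [firstA_eq hq1 hα2 hlam (qPoch_ne_zero_of_le hαm (by omega)), mul_div_assoc,
      mul_div_right_comm _ (qPochHom 0 1 (q ^ 2) n), mul_div_cancel_right₀ _ h0]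
    have e1 : (α ^ 2 * lam * a * b * q ^ (2 * (m : ℤ) - 2)) ^ n =
        (q ^ (2 * m)) ^ n * ((a / q ^ 2) ^ n * (b / q ^ 2) ^ n) * (α ^ 2 * q ^ 2) ^ n * lam ^ n := by
      simp only [← mul_pow]
      congr 1
      rw [zpow_sub₀ hq0, zpow_mul, zpow_natCast, pow_mul]
      norm_cast
      field_simp
    rw [e1]
    simp only [qPochs, List.map, List.prod_cons, List.prod_nil, mul_one]
    generalize 1 - α ^ 2 = w
    ring
  · rw [← pow_mul, mul_assoc, ← pow_add, add_comm 2]; exact hw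
  · convert hd using 2; field_simp
  · convert he using 2; field_simp

/-- The terminating second transformation. -/
theorem second_terminating {q : ℂ} (hq0 : q ≠ 0) (hq1 : ‖q‖ < 1) (m : ℕ) (α lam a b : ℂ)
    (hα : α ≠ 0) (hlam : lam ≠ 0) (ha : a ≠ 0) (hb : b ≠ 0) (hα2 : 1 + α ≠ 0)
    (hde : qPochs [α ^ 2 * a, α ^ 2 * b] (q ^ 2) m ≠ 0)
    (hden : qPochs [q * α, q ^ 2 * α, lam ^ 2, q ^ 4 / (α ^ 2 * a * b * q ^ (2 * m))] (q ^ 2) m ≠ 0)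
    (hw : qPoch (α ^ 2 * q ^ (2 * m + 2)) (q ^ 2) m ≠ 0) (hαm : qPoch α q m ≠ 0) :
    qPochs [α ^ 2 * q ^ 2, α ^ 2 * a * b / q ^ 2] (q ^ 2) m /
          qPochs [α ^ 2 * a, α ^ 2 * b] (q ^ 2) m *
        phi [q ^ (-2 * (m : ℤ)), q ^ 2 / a, q ^ 2 / b, lam, q * lam]
          [q * α, q ^ 2 * α, lam ^ 2, q ^ 4 / (α ^ 2 * a * b * q ^ (2 * m))]
          (q ^ 2) (q ^ 2) =
      ∑ n ∈ Finset.range (m + 1),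
        (1 + α * q ^ (2 * n)) *
            qPochs [q ^ (-2 * (m : ℤ)), α ^ 2, q ^ 2 / a, q ^ 2 / b] (q ^ 2) n *
            qPochs [-q, q * α / lam] q n *
            (α ^ 2 * lam * a * b * q ^ (2 * (m : ℤ) - 2)) ^ n /
          ((1 + α) *
            qPochs [q ^ 2, α ^ 2 * q ^ (2 * m + 2), α ^ 2 * a, α ^ 2 * b] (q ^ 2) n *
            qPochs [α, -lam] q n) := by
  have hp0 : q ^ 2 ≠ 0 := pow_ne_zero 2 hq0
  simp only [qPochs, List.map, List.prod_cons, List.prod_nil, mul_one, mul_ne_zero_iff] at hde hden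
  obtain ⟨hd, he⟩ := hde
  obtain ⟨h1, h2, h3, h4⟩ := hden
  have e0 : ∀ k, qPoch (α * q) q (2 * k) = qPoch (q * α) (q ^ 2) k * qPoch (q ^ 2 * α) (q ^ 2) k := by
    intro k
    rw [qPoch_two_mul, mul_comm α q, ← mul_assoc, ← sq]
  have hαm2 : qPoch (α * q) q (2 * m) ≠ 0 := by rw [e0]; exact mul_ne_zero h1 h2
  refine phi_terminating_eq hq0 hq1 (A := secondA α lam q) (B := secondB α lam q) ha hb ?_ h4 hd he
    ?_ ?_ (second_finite hq1 hαm2 h3 ?_ ?_ ?_)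
  · rw [← pow_mul]; field_simp
  · intro k
    simp only [secondB, qPochs, List.map, List.prod_cons, List.prod_nil, mul_one, e0,
      qPoch_two_mul lam, mul_assoc]
  · intro n hn
    have h0 : qPochHom 0 1 (q ^ 2) n ≠ 0 :=
      Finset.prod_ne_zero_iff.2 fun k _ => by simp [hq0]
    rw [secondA_eq hq1 hα2 hlam (qPoch_ne_zero_of_le hαm (by omega)), mul_div_assoc,
      mul_div_right_comm _ (qPochHom 0 1 (q ^ 2) n), mul_div_cancel_right₀ _ h0]
    have e1 : (α ^ 2 * lam * a * b * q ^ (2 * (m : ℤ) - 2)) ^ n =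
        (q ^ (2 * m)) ^ n * ((a / q ^ 2) ^ n * (b / q ^ 2) ^ n) * (α ^ 2 * q ^ 2) ^ n * lam ^ n := by
      simp only [← mul_pow]
      congr 1
      rw [zpow_sub₀ hq0, zpow_mul, zpow_natCast, pow_mul]
      norm_cast
      field_simp
    rw [e1]
    simp only [qPochs, List.map, List.prod_cons, List.prod_nil, mul_one]
    generalize 1 + α = w
    ring
  · rw [← pow_mul, mul_assoc, ← pow_add, add_comm 2]; exact hw
  · convert hd using 2; field_simp
  · convert he using 2; field_simp

/-! ### Convergence -/

lemma summable_norm_mul_pow {q : ℂ} (hq1 : ‖q‖ < 1) (a : ℂ) :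
    Summable fun k : ℕ => ‖-(a * q ^ k)‖ := by
  simp only [norm_neg, norm_mul, norm_pow]
  exact (summable_geometric_of_lt_one (norm_nonneg q) hq1).mul_left _

lemma tendsto_qPoch {q : ℂ} (hq1 : ‖q‖ < 1) (a : ℂ) :
    Tendsto (qPoch a q) atTop (𝓝 (qPochInf a q)) := by
  have h := (multipliable_one_add_of_summable (summable_norm_mul_pow hq1 a)).tendsto_prod_tprod_nat
  simp only [← sub_eq_add_neg] at h
  exact h

lemma qPochInf_ne_zero {q : ℂ} (hq1 : ‖q‖ < 1) {a : ℂ} (h : ∀ n, qPoch a q n ≠ 0) :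
    qPochInf a q ≠ 0 := by
  have h1 := tprod_one_add_ne_zero_of_summable (f := fun k : ℕ => -(a * q ^ k)) (fun k => ?_)
    (summable_norm_mul_pow hq1 a)
  · simp only [← sub_eq_add_neg] at h1
    exact h1
  · have := h (k + 1)
    rw [qPoch_succ] at this
    rw [← sub_eq_add_neg]
    exact right_ne_zero_of_mul this

lemma exists_norm_le_of_tendsto {f : ℕ → ℂ} {L : ℂ} (h : Tendsto f atTop (𝓝 L)) :
    ∃ C, ∀ n, ‖f n‖ ≤ C := by
  obtain ⟨C, hC⟩ := (Metric.isBounded_range_of_tendsto f h).exists_norm_le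
  exact ⟨C, fun n => hC _ ⟨n, rfl⟩⟩

lemma exists_norm_qPoch_le {q : ℂ} (hq1 : ‖q‖ < 1) (a : ℂ) : ∃ C, ∀ n, ‖qPoch a q n‖ ≤ C :=
  exists_norm_le_of_tendsto (tendsto_qPoch hq1 a)

lemma exists_norm_inv_qPoch_le {q : ℂ} (hq1 : ‖q‖ < 1) {a : ℂ} (h : ∀ n, qPoch a q n ≠ 0) :
    ∃ C, ∀ n, ‖(qPoch a q n)⁻¹‖ ≤ C :=
  exists_norm_le_of_tendsto ((tendsto_qPoch hq1 a).inv₀ (qPochInf_ne_zero hq1 h))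

lemma summable_mul_of_norm_le {f g : ℕ → ℂ} {C : ℝ} (hf : Summable f) (hg : ∀ n, ‖g n‖ ≤ C) :
    Summable fun n => f n * g n :=
  (hf.norm.mul_right C).of_norm_bounded fun n => by
    rw [norm_mul]
    exact mul_le_mul_of_nonneg_left (hg n) (norm_nonneg _)

lemma summable_of_ratio_tendsto {f ρ : ℕ → ℂ} {L : ℂ} (hf : ∀ n, f (n + 1) = f n * ρ n)
    (hρ : Tendsto ρ atTop (𝓝 L)) (hL : ‖L‖ < 1) : Summable f := by
  obtain ⟨r, hr, hr1⟩ := exists_between hL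
  refine summable_of_ratio_norm_eventually_le hr1 ?_
  filter_upwards [hρ.norm.eventually_le_const hr] with n hn
  rw [hf, norm_mul, mul_comm]
  exact mul_le_mul_of_nonneg_right hn (norm_nonneg _)

lemma tendsto_sub_mul_pow {q : ℂ} (hq1 : ‖q‖ < 1) (x y : ℂ) :
    Tendsto (fun n : ℕ => x - y * q ^ n) atTop (𝓝 x) := by
  have := ((tendsto_pow_atTop_nhds_zero_of_norm_lt_one hq1).const_mul y).const_sub x
  simpa using this

lemma summable_qPochHom_mul {p : ℂ} (hp1 : ‖p‖ < 1) {u v y : ℂ} (h : ‖y * u * v‖ < 1) :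
    Summable fun n => qPochHom u 1 p n * qPochHom v 1 p n * y ^ n := by
  refine summable_of_ratio_tendsto (ρ := fun n => (u - 1 * p ^ n) * (v - 1 * p ^ n) * y)
    (L := u * v * y) (fun n => ?_) ?_ (by rwa [mul_comm, ← mul_assoc])
  · rw [qPochHom_succ, qPochHom_succ]; ring
  · exact ((tendsto_sub_mul_pow hp1 u 1).mul (tendsto_sub_mul_pow hp1 v 1)).mul_const y

lemma summable_qPochHom_mul_mul {p q : ℂ} (hp1 : ‖p‖ < 1) (hq1 : ‖q‖ < 1) (u v y x c : ℂ) :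
    Summable fun n => qPochHom u 1 p n * qPochHom v 1 p n * y ^ n *
      (qPochHom x c q n * qPochHom 0 1 p n) := by
  refine summable_of_ratio_tendsto (ρ := fun n => (u - 1 * p ^ n) * (v - 1 * p ^ n) * y *
    ((x - c * q ^ n) * (0 - 1 * p ^ n))) (L := u * v * y * (x * 0)) (fun n => ?_) ?_ (by simp)
  · simp only [qPochHom_succ]; ring
  · exact (((tendsto_sub_mul_pow hp1 u 1).mul (tendsto_sub_mul_pow hp1 v 1)).mul_const y).mul
      ((tendsto_sub_mul_pow hq1 x c).mul (tendsto_sub_mul_pow hp1 0 1))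

lemma hasSum_of_forall_eq {ι : Type*} {f g : ι → ℂ} {a : ℂ} (h : HasSum f a)
    (hfg : ∀ n, f n = g n) : HasSum g a :=
  funext hfg ▸ h

/-- Tannery's theorem for sums of growing length. -/
lemma tendsto_sum_range_mul {f : ℕ → ℂ} {c : ℕ → ℕ → ℂ} {L : ℂ} {C : ℝ} (hf : Summable f)
    (hc : ∀ k, Tendsto (fun m => c m k) atTop (𝓝 L))
    (hC : ∀ᶠ m in atTop, ∀ k ≤ m, ‖c m k‖ ≤ C) :
    Tendsto (fun m => ∑ k ∈ Finset.range (m + 1), f k * c m k) atTop (𝓝 ((∑' k, f k) * L)) := by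
  rw [← tsum_mul_right]
  have h := tendsto_tsum_of_dominated_convergence (𝓕 := atTop) (bound := fun k => ‖f k‖ * |C|)
    (f := fun m k => if k ∈ Finset.range (m + 1) then f k * c m k else 0)
    (g := fun k => f k * L) (hf.norm.mul_right _) ?_ ?_
  · refine h.congr fun m => ?_
    rw [tsum_eq_sum (s := Finset.range (m + 1)) (fun k hk => if_neg hk)]
    exact Finset.sum_congr rfl fun k hk => if_pos hk
  · intro k
    refine ((hc k).const_mul (f k)).congr' ?_
    filter_upwards [eventually_ge_atTop k] with m hm
    rw [if_pos (Finset.mem_range.2 (by omega))]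
  · filter_upwards [hC] with m hm k
    split_ifs with h
    · rw [norm_mul]
      exact mul_le_mul_of_nonneg_left
        ((hm k (Nat.lt_succ_iff.1 (Finset.mem_range.1 h))).trans (le_abs_self C)) (norm_nonneg _)
    · rw [norm_zero]; positivity

lemma tendsto_qPoch_sub {q : ℂ} (hq1 : ‖q‖ < 1) (a : ℂ) (k : ℕ) :
    Tendsto (fun m => qPoch a q (m - k)) atTop (𝓝 (qPochInf a q)) :=
  (tendsto_qPoch hq1 a).comp (tendsto_sub_atTop_nat k)

lemma tendsto_qPoch_mul_pow {p : ℂ} (hp1 : ‖p‖ < 1) (w : ℂ) (k : ℕ) :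
    Tendsto (fun m => qPoch (w * p ^ m) p k) atTop (𝓝 1) := by
  have h0 : Tendsto (fun m : ℕ => w * p ^ m) atTop (𝓝 0) := by
    simpa using (tendsto_pow_atTop_nhds_zero_of_norm_lt_one hp1).const_mul w
  have h1 : ContinuousAt (fun y => qPoch y p k) 0 := continuousAt_qPoch continuousAt_id p k
  have h2 : qPoch 0 p k = 1 := by simp [qPoch]
  have := h1.tendsto.comp h0
  rwa [h2] at this

/-- The bound is uniform in `k` and `m`: once `‖w p^m‖ ≤ ‖p‖`, each factor of `(w p^m; p)_k` is at
least the corresponding factor of `(‖p‖; ‖p‖)_k` in absolute value. -/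
lemma exists_eventually_norm_inv_qPoch_le {p : ℂ} (hp1 : ‖p‖ < 1) (w : ℂ) :
    ∃ C, ∀ᶠ m : ℕ in atTop, ∀ k, ‖(qPoch (w * p ^ m) p k)⁻¹‖ ≤ C := by
  rcases eq_or_ne p 0 with rfl | hp0
  · refine ⟨1, ?_⟩
    filter_upwards [eventually_ge_atTop 1] with m hm k
    simp [zero_pow (show m ≠ 0 by omega), qPoch]
  have hn : ‖((‖p‖ : ℝ) : ℂ)‖ < 1 := by simpa using hp1
  obtain ⟨C, hC⟩ := exists_norm_inv_qPoch_le hn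
    (fun n => qPoch_self_ne_zero (pow_succ_ne_one_of_norm_lt_one hn) n)
  have h0 : Tendsto (fun m : ℕ => w * p ^ m) atTop (𝓝 0) := by
    simpa using (tendsto_pow_atTop_nhds_zero_of_norm_lt_one hp1).const_mul w
  have h0n : Tendsto (fun m : ℕ => ‖w * p ^ m‖) atTop (𝓝 0) := by simpa using h0.norm
  refine ⟨C, ?_⟩
  filter_upwards [h0n.eventually_le_const (norm_pos_iff.2 hp0)] with m hm k
  refine le_trans ?_ (hC k)
  simp only [norm_inv, qPoch, norm_prod]
  have hpos : ∀ i : ℕ, 0 < ‖1 - ((‖p‖ : ℝ) : ℂ) * ((‖p‖ : ℝ) : ℂ) ^ i‖ := by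
    intro i
    rw [norm_pos_iff, ← pow_succ']
    exact sub_ne_zero.2 (pow_succ_ne_one_of_norm_lt_one hn i).symm
  refine inv_anti₀ (Finset.prod_pos fun i _ => hpos i) ?_
  refine Finset.prod_le_prod (fun i _ => norm_nonneg _) fun i _ => ?_
  have e1 : (1 : ℂ) - ((‖p‖ : ℝ) : ℂ) * ((‖p‖ : ℝ) : ℂ) ^ i = ((1 - ‖p‖ * ‖p‖ ^ i : ℝ) : ℂ) := by
    push_cast; ring
  have h1 : ‖p‖ * ‖p‖ ^ i ≤ 1 := by
    rw [← pow_succ']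
    exact pow_le_one₀ (norm_nonneg _) hp1.le
  rw [e1, Complex.norm_real, Real.norm_of_nonneg (by linarith)]
  have h2 : ‖w * p ^ m * p ^ i‖ ≤ ‖p‖ * ‖p‖ ^ i := by
    rw [norm_mul, norm_pow p i]
    exact mul_le_mul_of_nonneg_right hm (by positivity)
  have h3 := norm_sub_norm_le (1 : ℂ) (w * p ^ m * p ^ i)
  rw [norm_one] at h3
  linarith

lemma eventually_qPoch_mul_pow_ne_zero {p : ℂ} (hp1 : ‖p‖ < 1) (w : ℂ) :
    ∀ᶠ m : ℕ in atTop, ∀ k, qPoch (w * p ^ m) p k ≠ 0 := by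
  have h0 : Tendsto (fun m : ℕ => w * p ^ m) atTop (𝓝 0) := by
    simpa using (tendsto_pow_atTop_nhds_zero_of_norm_lt_one hp1).const_mul w
  have h0n : Tendsto (fun m : ℕ => ‖w * p ^ m‖) atTop (𝓝 0) := by simpa using h0.norm
  filter_upwards [h0n.eventually_lt_const one_pos] with m hm k
  refine Finset.prod_ne_zero_iff.2 fun i _ h => ?_
  have h2 : ‖w * p ^ m * p ^ i‖ < 1 := by
    rw [norm_mul, norm_pow p i]
    exact mul_lt_one_of_nonneg_of_lt_one_left (norm_nonneg _) hm
      (pow_le_one₀ (norm_nonneg _) hp1.le)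
  rw [← sub_eq_zero.1 h, norm_one] at h2
  exact lt_irrefl _ h2

/-! ### The nonterminating transformations -/

/-- The limit `m → ∞` of the finite Bailey lemma. -/
theorem tsum_eq_of_finite {p : ℂ} (hp1 : ‖p‖ < 1) {w z d e : ℂ} {f g : ℕ → ℂ}
    (hd : ∀ n, qPoch d p n ≠ 0) (he : ∀ n, qPoch e p n ≠ 0) (hf : Summable f) (hg : Summable g)
    (key : ∀ m, qPoch (w * p ^ m) p m ≠ 0 →
      qPoch w p m * ∑ k ∈ Finset.range (m + 1), f k * (qPoch z p (m - k) / qPoch p p (m - k)) =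
      qPoch d p m * qPoch e p m * ∑ r ∈ Finset.range (m + 1),
        g r * (qPoch p p (m - r) * qPoch (w * p ^ m) p r)⁻¹) :
    ∑' n, g n = qPochInf w p * qPochInf z p / (qPochInf d p * qPochInf e p) * ∑' n, f n := by
  have hpp := qPoch_self_ne_zero (pow_succ_ne_one_of_norm_lt_one hp1)
  have hpi := qPochInf_ne_zero hp1 hpp
  have hdi := qPochInf_ne_zero hp1 hd
  have hei := qPochInf_ne_zero hp1 he
  obtain ⟨C1, hC1⟩ := exists_norm_inv_qPoch_le hp1 hpp
  obtain ⟨C2, hC2⟩ := exists_norm_qPoch_le hp1 z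
  obtain ⟨C3, hC3⟩ := exists_eventually_norm_inv_qPoch_le hp1 w
  have hC1' : 0 ≤ C1 := (norm_nonneg _).trans (hC1 0)
  have hC2' : 0 ≤ C2 := (norm_nonneg _).trans (hC2 0)
  have hl : Tendsto (fun m => qPoch w p m * ∑ k ∈ Finset.range (m + 1),
      f k * (qPoch z p (m - k) / qPoch p p (m - k))) atTop
      (𝓝 (qPochInf w p * ((∑' n, f n) * (qPochInf z p / qPochInf p p)))) := by
    refine (tendsto_qPoch hp1 w).mul (tendsto_sum_range_mul (C := C2 * C1) hf (fun k => ?_) ?_)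
    · exact (tendsto_qPoch_sub hp1 z k).div (tendsto_qPoch_sub hp1 p k) hpi
    · refine Eventually.of_forall fun m k _ => ?_
      rw [div_eq_mul_inv, norm_mul]
      exact mul_le_mul (hC2 _) (hC1 _) (norm_nonneg _) hC2'
  have hr : Tendsto (fun m => qPoch d p m * qPoch e p m * ∑ r ∈ Finset.range (m + 1),
      g r * (qPoch p p (m - r) * qPoch (w * p ^ m) p r)⁻¹) atTop
      (𝓝 (qPochInf d p * qPochInf e p * ((∑' n, g n) * (qPochInf p p * 1)⁻¹))) := by
    refine ((tendsto_qPoch hp1 d).mul (tendsto_qPoch hp1 e)).mul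
      (tendsto_sum_range_mul (C := C1 * C3) hg (fun k => ?_) ?_)
    · exact ((tendsto_qPoch_sub hp1 p k).mul (tendsto_qPoch_mul_pow hp1 w k)).inv₀
        (mul_ne_zero hpi one_ne_zero)
    · filter_upwards [hC3] with m hm k _
      rw [mul_inv, norm_mul]
      exact mul_le_mul (hC1 _) (hm k) (norm_nonneg _) hC1'
  have h := tendsto_nhds_unique_of_eventuallyEq hl hr (by
    filter_upwards [eventually_qPoch_mul_pow_ne_zero hp1 w] with m hm using key m (hm m))
  rw [div_mul_eq_mul_div, eq_div_iff (mul_ne_zero hdi hei)]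
  field_simp at h
  linear_combination -h

lemma exists_norm_vwpFactor_le {q : ℂ} (hq1 : ‖q‖ < 1) (A : ℂ) :
    ∃ C, ∀ n, ‖vwpFactor A q n‖ ≤ C := by
  have h : Tendsto (fun n => vwpFactor A q (n + 1)) atTop (𝓝 (1 * qPochInf (A * q) q)) := by
    refine Tendsto.mul ?_ (tendsto_qPoch hq1 (A * q))
    have h2 := (tendsto_sub_mul_pow (norm_sq_lt_one hq1) 1 A).comp (tendsto_add_atTop_nat 1)
    refine h2.congr fun n => ?_
    simp [pow_mul]
  exact exists_norm_le_of_tendsto ((tendsto_add_atTop_iff_nat 1).1 h)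

lemma summable_secondA {q : ℂ} (hq1 : ‖q‖ < 1) {α lam u v d e y : ℂ}
    (hd : ∀ n, qPoch d (q ^ 2) n ≠ 0) (he : ∀ n, qPoch e (q ^ 2) n ≠ 0)
    (hl : ∀ n, qPoch (-lam) q n ≠ 0) :
    Summable fun n => qPochHom u 1 (q ^ 2) n * qPochHom v 1 (q ^ 2) n * y ^ n * secondA α lam q n /
      (qPoch d (q ^ 2) n * qPoch e (q ^ 2) n) := by
  have hp1 := norm_sq_lt_one hq1
  obtain ⟨C1, h1⟩ := exists_norm_vwpFactor_le hq1 (-α)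
  obtain ⟨C2, h2⟩ := exists_norm_inv_qPoch_le hq1
    (qPoch_self_ne_zero (pow_succ_ne_one_of_norm_lt_one hq1))
  obtain ⟨C3, h3⟩ := exists_norm_inv_qPoch_le hq1 hl
  obtain ⟨C4, h4⟩ := exists_norm_inv_qPoch_le hp1 hd
  obtain ⟨C5, h5⟩ := exists_norm_inv_qPoch_le hp1 he
  have := summable_mul_of_norm_le (summable_mul_of_norm_le (summable_mul_of_norm_le
    (summable_mul_of_norm_le (summable_mul_of_norm_le
    (summable_qPochHom_mul_mul hp1 hq1 u v y lam (α * q)) h1) h2) h3) h4) h5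
  refine this.congr fun n => ?_
  rw [secondA]
  simp only [div_eq_mul_inv, mul_inv]
  ring

lemma summable_firstA {q : ℂ} (hq1 : ‖q‖ < 1) {α lam u v d e y : ℂ}
    (hd : ∀ n, qPoch d (q ^ 2) n ≠ 0) (he : ∀ n, qPoch e (q ^ 2) n ≠ 0)
    (hl : ∀ n, qPoch (-(q * lam)) q n ≠ 0) :
    Summable fun n => qPochHom u 1 (q ^ 2) n * qPochHom v 1 (q ^ 2) n * y ^ n * firstA α lam q n /
      (qPoch d (q ^ 2) n * qPoch e (q ^ 2) n) := by
  have hp1 := norm_sq_lt_one hq1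
  obtain ⟨C1, h1⟩ := exists_norm_vwpFactor_le hq1 (-α)
  obtain ⟨C2, h2⟩ := exists_norm_inv_qPoch_le hq1
    (qPoch_self_ne_zero (pow_succ_ne_one_of_norm_lt_one hq1))
  obtain ⟨C3, h3⟩ := exists_norm_inv_qPoch_le hq1 hl
  obtain ⟨C4, h4⟩ := exists_norm_inv_qPoch_le hp1 hd
  obtain ⟨C5, h5⟩ := exists_norm_inv_qPoch_le hp1 he
  obtain ⟨C6, h6⟩ := exists_norm_le_of_tendsto (tendsto_sub_mul_pow hp1 1 α)
  have := (summable_mul_of_norm_le (summable_mul_of_norm_le (summable_mul_of_norm_le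
    (summable_mul_of_norm_le (summable_mul_of_norm_le (summable_mul_of_norm_le
    (summable_qPochHom_mul_mul hp1 hq1 u v y lam α) h1) h2) h3) h4) h5) h6).mul_right (1 - α)⁻¹
  refine this.congr fun n => ?_
  rw [firstA]
  simp only [div_eq_mul_inv, mul_inv, pow_mul]
  ring

/-- The nonterminating first transformation, with `u = a / q²` and `v = b / q²`; here `u`, `v` and
`lam` may be zero. -/
theorem first_nonterminating {q : ℂ} (hq0 : q ≠ 0) (hq1 : ‖q‖ < 1) {α lam u v : ℂ}
    (hα : 1 - α ≠ 0) (hz : ‖α ^ 2 * q ^ 2 * u * v‖ < 1) (hα2 : ∀ n, qPoch α q n ≠ 0)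
    (hl : ∀ n, qPoch (q ^ 2 * lam ^ 2) (q ^ 2) n ≠ 0)
    (hd : ∀ n, qPoch (α ^ 2 * q ^ 2 * u) (q ^ 2) n ≠ 0)
    (he : ∀ n, qPoch (α ^ 2 * q ^ 2 * v) (q ^ 2) n ≠ 0) :
    Summable (fun n => qPochHom u 1 (q ^ 2) n * qPochHom v 1 (q ^ 2) n * (α ^ 2 * q ^ 2) ^ n *
      firstB α lam q n) ∧
    HasSum (fun n => qPochHom u 1 (q ^ 2) n * qPochHom v 1 (q ^ 2) n * (α ^ 2 * q ^ 2) ^ n *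
        firstA α lam q n /
        (qPoch (α ^ 2 * q ^ 2 * u) (q ^ 2) n * qPoch (α ^ 2 * q ^ 2 * v) (q ^ 2) n))
      (qPochInf (α ^ 2 * q ^ 2) (q ^ 2) * qPochInf (α ^ 2 * q ^ 2 * u * v) (q ^ 2) /
        (qPochInf (α ^ 2 * q ^ 2 * u) (q ^ 2) * qPochInf (α ^ 2 * q ^ 2 * v) (q ^ 2)) *
        ∑' n, qPochHom u 1 (q ^ 2) n * qPochHom v 1 (q ^ 2) n * (α ^ 2 * q ^ 2) ^ n *
          firstB α lam q n) := by
  have hp1 := norm_sq_lt_one hq1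
  have hl' : ∀ n, qPoch (-(q * lam)) q n ≠ 0 := by
    intro n
    have := hl n
    rw [← mul_pow, qPoch_sq] at this
    exact right_ne_zero_of_mul this
  have hB : Summable (fun n => qPochHom u 1 (q ^ 2) n * qPochHom v 1 (q ^ 2) n *
      (α ^ 2 * q ^ 2) ^ n * firstB α lam q n) := by
    obtain ⟨C1, h1⟩ := exists_norm_qPoch_le hq1 lam
    obtain ⟨C2, h2⟩ := exists_norm_inv_qPoch_le hq1 hα2
    obtain ⟨C3, h3⟩ := exists_norm_inv_qPoch_le hp1
      (qPoch_self_ne_zero (pow_succ_ne_one_of_norm_lt_one hp1))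
    obtain ⟨C4, h4⟩ := exists_norm_inv_qPoch_le hp1 hl
    refine (summable_mul_of_norm_le (summable_mul_of_norm_le (summable_mul_of_norm_le
      (summable_mul_of_norm_le (summable_qPochHom_mul hp1 hz) (fun n => h1 (2 * n)))
      (fun n => h2 (2 * n))) h3) h4).congr fun n => ?_
    rw [firstB]
    simp only [div_eq_mul_inv, mul_inv]
    ring
  have hA := summable_firstA hq1 (α := α) (u := u) (v := v) (y := α ^ 2 * q ^ 2) hd he hl'
  refine ⟨hB, ?_⟩
  rw [← tsum_eq_of_finite hp1 hd he hB hA]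
  · exact hA.hasSum
  · intro m hm
    rw [first_finite hq0 hq1 hα (hα2 _) (hl m) hm (hd m) (he m)]
    simp only [div_eq_mul_inv, mul_inv, mul_assoc]

/-- The nonterminating second transformation, with `u = a / q²` and `v = b / q²`; here `u`, `v` and
`lam` may be zero, and `α = -1` is allowed. -/
theorem second_nonterminating {q : ℂ} (hq1 : ‖q‖ < 1) {α lam u v : ℂ}
    (hz : ‖α ^ 2 * q ^ 2 * u * v‖ < 1) (hα2 : ∀ n, qPoch (α * q) q n ≠ 0)
    (hl : ∀ n, qPoch (lam ^ 2) (q ^ 2) n ≠ 0)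
    (hd : ∀ n, qPoch (α ^ 2 * q ^ 2 * u) (q ^ 2) n ≠ 0)
    (he : ∀ n, qPoch (α ^ 2 * q ^ 2 * v) (q ^ 2) n ≠ 0) :
    Summable (fun n => qPochHom u 1 (q ^ 2) n * qPochHom v 1 (q ^ 2) n * (α ^ 2 * q ^ 2) ^ n *
      secondB α lam q n) ∧
    HasSum (fun n => qPochHom u 1 (q ^ 2) n * qPochHom v 1 (q ^ 2) n * (α ^ 2 * q ^ 2) ^ n *
        secondA α lam q n /
        (qPoch (α ^ 2 * q ^ 2 * u) (q ^ 2) n * qPoch (α ^ 2 * q ^ 2 * v) (q ^ 2) n))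
      (qPochInf (α ^ 2 * q ^ 2) (q ^ 2) * qPochInf (α ^ 2 * q ^ 2 * u * v) (q ^ 2) /
        (qPochInf (α ^ 2 * q ^ 2 * u) (q ^ 2) * qPochInf (α ^ 2 * q ^ 2 * v) (q ^ 2)) *
        ∑' n, qPochHom u 1 (q ^ 2) n * qPochHom v 1 (q ^ 2) n * (α ^ 2 * q ^ 2) ^ n *
          secondB α lam q n) := by
  have hp1 := norm_sq_lt_one hq1
  have hl' : ∀ n, qPoch (-lam) q n ≠ 0 := by
    intro n
    have := hl n
    rw [qPoch_sq] at this
    exact right_ne_zero_of_mul this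
  have hB : Summable (fun n => qPochHom u 1 (q ^ 2) n * qPochHom v 1 (q ^ 2) n *
      (α ^ 2 * q ^ 2) ^ n * secondB α lam q n) := by
    obtain ⟨C1, h1⟩ := exists_norm_qPoch_le hq1 lam
    obtain ⟨C2, h2⟩ := exists_norm_inv_qPoch_le hq1 hα2
    obtain ⟨C3, h3⟩ := exists_norm_inv_qPoch_le hp1
      (qPoch_self_ne_zero (pow_succ_ne_one_of_norm_lt_one hp1))
    obtain ⟨C4, h4⟩ := exists_norm_inv_qPoch_le hp1 hl
    refine (summable_mul_of_norm_le (summable_mul_of_norm_le (summable_mul_of_norm_le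
      (summable_mul_of_norm_le (summable_qPochHom_mul hp1 hz) (fun n => h1 (2 * n)))
      (fun n => h2 (2 * n))) h3) h4).congr fun n => ?_
    rw [secondB]
    simp only [div_eq_mul_inv, mul_inv]
    ring
  have hA := summable_secondA hq1 (α := α) (u := u) (v := v) (y := α ^ 2 * q ^ 2) hd he hl'
  refine ⟨hB, ?_⟩
  rw [← tsum_eq_of_finite hp1 hd he hB hA]
  · exact hA.hasSum
  · intro m hm
    rw [second_finite hq1 (hα2 _) (hl m) hm (hd m) (he m)]
    simp only [div_eq_mul_inv, mul_inv, mul_assoc]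

lemma phiTerm_nonterminating {q : ℂ} (hq0 : q ≠ 0) {α a b : ℂ} (l₁ l₂ d₁ d₂ d₃ : ℂ)
    (ha : a ≠ 0) (hb : b ≠ 0) (n : ℕ) :
    phiTerm [q ^ 2 / a, q ^ 2 / b, l₁, l₂] [d₁, d₂, d₃] (q ^ 2) (α ^ 2 * a * b / q ^ 2) n =
      qPochHom (a / q ^ 2) 1 (q ^ 2) n * qPochHom (b / q ^ 2) 1 (q ^ 2) n * (α ^ 2 * q ^ 2) ^ n *
        (qPochs [l₁, l₂] (q ^ 2) n / qPochs [d₁, d₂, q ^ 2, d₃] (q ^ 2) n) := by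
  have hp0 : q ^ 2 ≠ 0 := pow_ne_zero 2 hq0
  rw [qPochHom_eq_pow_mul (div_ne_zero ha hp0), qPochHom_eq_pow_mul (div_ne_zero hb hp0),
    one_div_div, one_div_div]
  simp only [phiTerm, qPochs, List.map, List.prod_cons, List.prod_nil, mul_one, List.length]
  norm_num
  have e1 : (α ^ 2 * a * b / q ^ 2) ^ n =
      (a / q ^ 2) ^ n * (b / q ^ 2) ^ n * (α ^ 2 * q ^ 2) ^ n := by
    rw [← mul_pow, ← mul_pow]; congr 1; field_simp
  rw [e1]
  ring

lemma qPochHom_zero_one_sq {q : ℂ} (hq0 : q ≠ 0) (n : ℕ) :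
    qPochHom 0 1 (q ^ 2) n = (-1) ^ n * (q ^ 2) ^ n * q ^ ((n : ℤ) ^ 2 - 3 * (n : ℤ)) := by
  induction n with
  | zero => simp [qPochHom_zero]
  | succ n ih =>
    have e1 : (((n + 1 : ℕ) : ℤ)) ^ 2 - 3 * ((n + 1 : ℕ) : ℤ) =
        ((n : ℤ) ^ 2 - 3 * (n : ℤ)) + (2 * (n : ℤ)) + (-2) := by push_cast; ring
    rw [qPochHom_succ, ih, e1, zpow_add₀ hq0, zpow_add₀ hq0, zpow_mul, zpow_natCast]
    simp only [zpow_neg, zpow_ofNat]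
    field_simp
    ring

/-- The limit `m → ∞` of the first transformation, in the parameters `a = q² u` and `b = q² v`. -/
theorem first_limit {q : ℂ} (hq0 : q ≠ 0) (hq1 : ‖q‖ < 1) (α lam a b : ℂ) (hlam : lam ≠ 0)
    (ha : a ≠ 0) (hb : b ≠ 0) (hα : 1 - α ^ 2 ≠ 0) (hz : ‖α ^ 2 * a * b / q ^ 2‖ < 1)
    (hden : ∀ n : ℕ, qPochs [α ^ 2 * a, α ^ 2 * b, α, q * α, q ^ 2 * lam ^ 2] (q ^ 2) n ≠ 0) :
    Summable (phiTerm [q ^ 2 / a, q ^ 2 / b, lam, q * lam] [α, q * α, q ^ 2 * lam ^ 2]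
      (q ^ 2) (α ^ 2 * a * b / q ^ 2)) ∧
    HasSum
      (fun n : ℕ =>
        (1 - α ^ 2 * q ^ (4 * n)) *
            qPochs [α ^ 2, q ^ 2 / a, q ^ 2 / b] (q ^ 2) n *
            qPochs [-q, α / lam] q n *
            (-α ^ 2 * lam * a * b) ^ n * q ^ ((n : ℤ) ^ 2 - 3 * (n : ℤ)) /
          ((1 - α ^ 2) *
            qPochs [q ^ 2, α ^ 2 * a, α ^ 2 * b] (q ^ 2) n *
            qPochs [α, -q * lam] q n))
      (qPochsInf [α ^ 2 * q ^ 2, α ^ 2 * a * b / q ^ 2] (q ^ 2) /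
          qPochsInf [α ^ 2 * a, α ^ 2 * b] (q ^ 2) *
        phi [q ^ 2 / a, q ^ 2 / b, lam, q * lam] [α, q * α, q ^ 2 * lam ^ 2]
          (q ^ 2) (α ^ 2 * a * b / q ^ 2)) := by
  have hp0 : q ^ 2 ≠ 0 := pow_ne_zero 2 hq0
  simp only [qPochs, List.map, List.prod_cons, List.prod_nil, mul_one, mul_ne_zero_iff] at hden
  have e0 : 1 - α ^ 2 = (1 - α) * (1 + α) := by ring
  have hα2 : ∀ n, qPoch α q n ≠ 0 := fun n => by
    have : qPoch α q (2 * n) ≠ 0 := by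
      rw [qPoch_two_mul]; exact mul_ne_zero (hden n).2.2.1 (hden n).2.2.2.1
    exact qPoch_ne_zero_of_le this (by omega)
  have e1 : α ^ 2 * q ^ 2 * (a / q ^ 2) = α ^ 2 * a := by field_simp
  have e2 : α ^ 2 * q ^ 2 * (b / q ^ 2) = α ^ 2 * b := by field_simp
  have e3 : α ^ 2 * a * (b / q ^ 2) = α ^ 2 * a * b / q ^ 2 := by ring
  have hphi : ∀ n, phiTerm [q ^ 2 / a, q ^ 2 / b, lam, q * lam] [α, q * α, q ^ 2 * lam ^ 2]
      (q ^ 2) (α ^ 2 * a * b / q ^ 2) n = qPochHom (a / q ^ 2) 1 (q ^ 2) n *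
        qPochHom (b / q ^ 2) 1 (q ^ 2) n * (α ^ 2 * q ^ 2) ^ n * firstB α lam q n := by
    intro n
    rw [phiTerm_nonterminating hq0 _ _ _ _ _ ha hb]
    simp only [firstB, qPochs, List.map, List.prod_cons, List.prod_nil, mul_one, qPoch_two_mul,
      mul_assoc]
  have key := first_nonterminating hq0 hq1 (α := α) (lam := lam) (u := a / q ^ 2) (v := b / q ^ 2)
    (left_ne_zero_of_mul (e0 ▸ hα)) (by rwa [e1, e3]) hα2 (fun n => (hden n).2.2.2.2)
    (fun n => by rw [e1]; exact (hden n).1) (fun n => by rw [e2]; exact (hden n).2.1)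
  rw [e1, e2, e3] at key
  refine ⟨key.1.congr fun n => (hphi n).symm, ?_⟩
  rw [phi, tsum_congr hphi]
  simp only [qPochsInf, List.map, List.prod_cons, List.prod_nil, mul_one]
  refine hasSum_of_forall_eq key.2 fun n => ?_
  rw [firstA_eq hq1 hα hlam (hα2 n), qPochHom_eq_pow_mul (div_ne_zero ha hp0),
    qPochHom_eq_pow_mul (div_ne_zero hb hp0), one_div_div, one_div_div, qPochHom_zero_one_sq hq0]
  have e4 : (-α ^ 2 * lam * a * b) ^ n = (-1) ^ n * (q ^ 2) ^ n * ((a / q ^ 2) ^ n *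
      (b / q ^ 2) ^ n) * (α ^ 2 * q ^ 2) ^ n * lam ^ n := by
    simp only [← mul_pow]
    congr 1
    field_simp
  rw [e4]
  simp only [qPochs, List.map, List.prod_cons, List.prod_nil, mul_one]
  generalize 1 - α ^ 2 = w
  ring

/-- The limit `m → ∞` of the second transformation, in the parameters `a = q² u` and `b = q² v`. -/
theorem second_limit {q : ℂ} (hq0 : q ≠ 0) (hq1 : ‖q‖ < 1) (α lam a b : ℂ) (hlam : lam ≠ 0)
    (ha : a ≠ 0) (hb : b ≠ 0) (hα : 1 + α ≠ 0) (hz : ‖α ^ 2 * a * b / q ^ 2‖ < 1)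
    (hden : ∀ n : ℕ, qPochs [α ^ 2 * a, α ^ 2 * b, q * α, q ^ 2 * α, lam ^ 2] (q ^ 2) n ≠ 0)
    (hα2 : ∀ n : ℕ, qPoch α q n ≠ 0) :
    Summable (phiTerm [q ^ 2 / a, q ^ 2 / b, lam, q * lam] [q * α, q ^ 2 * α, lam ^ 2]
      (q ^ 2) (α ^ 2 * a * b / q ^ 2)) ∧
    HasSum
      (fun n : ℕ =>
        (1 + α * q ^ (2 * n)) *
            qPochs [α ^ 2, q ^ 2 / a, q ^ 2 / b] (q ^ 2) n *
            qPochs [-q, q * α / lam] q n *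
            (-α ^ 2 * lam * a * b) ^ n * q ^ ((n : ℤ) ^ 2 - 3 * (n : ℤ)) /
          ((1 + α) *
            qPochs [q ^ 2, α ^ 2 * a, α ^ 2 * b] (q ^ 2) n *
            qPochs [α, -lam] q n))
      (qPochsInf [α ^ 2 * q ^ 2, α ^ 2 * a * b / q ^ 2] (q ^ 2) /
          qPochsInf [α ^ 2 * a, α ^ 2 * b] (q ^ 2) *
        phi [q ^ 2 / a, q ^ 2 / b, lam, q * lam] [q * α, q ^ 2 * α, lam ^ 2]
          (q ^ 2) (α ^ 2 * a * b / q ^ 2)) := by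
  have hp0 : q ^ 2 ≠ 0 := pow_ne_zero 2 hq0
  simp only [qPochs, List.map, List.prod_cons, List.prod_nil, mul_one, mul_ne_zero_iff] at hden
  have e0 : ∀ k, qPoch (α * q) q (2 * k) = qPoch (q * α) (q ^ 2) k * qPoch (q ^ 2 * α) (q ^ 2) k := by
    intro k
    rw [qPoch_two_mul, mul_comm α q, ← mul_assoc, ← sq]
  have hα3 : ∀ n, qPoch (α * q) q n ≠ 0 := fun n => by
    have := hα2 (n + 1)
    rw [qPoch_succ'] at this
    exact right_ne_zero_of_mul this
  have e1 : α ^ 2 * q ^ 2 * (a / q ^ 2) = α ^ 2 * a := by field_simp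
  have e2 : α ^ 2 * q ^ 2 * (b / q ^ 2) = α ^ 2 * b := by field_simp
  have e3 : α ^ 2 * a * (b / q ^ 2) = α ^ 2 * a * b / q ^ 2 := by ring
  have hphi : ∀ n, phiTerm [q ^ 2 / a, q ^ 2 / b, lam, q * lam] [q * α, q ^ 2 * α, lam ^ 2]
      (q ^ 2) (α ^ 2 * a * b / q ^ 2) n = qPochHom (a / q ^ 2) 1 (q ^ 2) n *
        qPochHom (b / q ^ 2) 1 (q ^ 2) n * (α ^ 2 * q ^ 2) ^ n * secondB α lam q n := by
    intro n
    rw [phiTerm_nonterminating hq0 _ _ _ _ _ ha hb]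
    simp only [secondB, qPochs, List.map, List.prod_cons, List.prod_nil, mul_one, e0,
      qPoch_two_mul lam, mul_assoc]
  have key := second_nonterminating hq1 (α := α) (lam := lam) (u := a / q ^ 2) (v := b / q ^ 2)
    (by rwa [e1, e3]) hα3 (fun n => (hden n).2.2.2.2)
    (fun n => by rw [e1]; exact (hden n).1) (fun n => by rw [e2]; exact (hden n).2.1)
  rw [e1, e2, e3] at key
  refine ⟨key.1.congr fun n => (hphi n).symm, ?_⟩
  rw [phi, tsum_congr hphi]
  simp only [qPochsInf, List.map, List.prod_cons, List.prod_nil, mul_one]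
  refine hasSum_of_forall_eq key.2 fun n => ?_
  rw [secondA_eq hq1 hα hlam (hα2 n), qPochHom_eq_pow_mul (div_ne_zero ha hp0),
    qPochHom_eq_pow_mul (div_ne_zero hb hp0), one_div_div, one_div_div, qPochHom_zero_one_sq hq0]
  have e4 : (-α ^ 2 * lam * a * b) ^ n = (-1) ^ n * (q ^ 2) ^ n * ((a / q ^ 2) ^ n *
      (b / q ^ 2) ^ n) * (α ^ 2 * q ^ 2) ^ n * lam ^ n := by
    simp only [← mul_pow]
    congr 1
    field_simp
  rw [e4]
  simp only [qPochs, List.map, List.prod_cons, List.prod_nil, mul_one]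
  generalize 1 + α = w
  ring

/-! ### The Jacobi triple product -/

lemma qPoch_zero_left (q : ℂ) (n : ℕ) : qPoch 0 q n = 1 := by simp [qPoch]

/-- The `q`-binomial theorem, as a degenerate case of the `q`-Pfaff–Saalschütz sum. -/
lemma q_binomial {p : ℂ} (hp : ∀ k : ℕ, p ^ (k + 1) ≠ 1) (x : ℂ) (M : ℕ) :
    ∑ j ∈ Finset.range (M + 1), qPochHom 0 x p j / (qPoch p p (M - j) * qPoch p p j) =
      qPoch x p M / qPoch p p M := by
  have key := saalschutz hp 1 0 0 x 1 M (by simp [qPoch_zero_left])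
  have e1 : ∀ n, qPochHom 1 0 p n = 1 := fun n => by simp [qPochHom]
  simpa [qPoch_zero_left, e1] using key

lemma qPochHom_zero_ne_zero {x p : ℂ} (hx : x ≠ 0) (hp0 : p ≠ 0) (n : ℕ) :
    qPochHom 0 x p n ≠ 0 :=
  Finset.prod_ne_zero_iff.2 fun k _ => by simp [hx, hp0]

lemma qPoch_eq_qPochHom_mul_reverse {p x y : ℂ} {N : ℕ} (h : y * x * p ^ N = p) (hp0 : p ≠ 0) :
    qPoch x p N = qPochHom 0 x p N * qPoch y p N := by
  rw [qPoch, qPochHom, qPoch, ← Finset.prod_range_reflect (fun k => 1 - y * p ^ k),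
    ← Finset.prod_mul_distrib]
  refine Finset.prod_congr rfl fun j hj => ?_
  obtain ⟨e, rfl⟩ := Nat.exists_eq_add_of_lt (Finset.mem_range.1 hj)
  have e1 : j + e + 1 - 1 - j = e := by omega
  rw [e1]
  have h2 : y * x * (p ^ j * p ^ e) = 1 := by
    apply mul_right_cancel₀ hp0
    rw [one_mul]
    conv_rhs => rw [← h]
    ring
  linear_combination -h2

lemma qPochHom_zero_mul_reverse {p x y : ℂ} {i : ℕ} (h : y * x * p ^ i = p) (hp0 : p ≠ 0) :
    qPochHom 0 x p i * qPochHom 0 y p i = 1 := by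
  rw [qPochHom, qPochHom, ← Finset.prod_range_reflect (fun k => 0 - y * p ^ k),
    ← Finset.prod_mul_distrib]
  refine Finset.prod_eq_one fun j hj => ?_
  obtain ⟨e, rfl⟩ := Nat.exists_eq_add_of_lt (Finset.mem_range.1 hj)
  have e1 : j + e + 1 - 1 - j = e := by omega
  rw [e1]
  apply mul_right_cancel₀ hp0
  rw [one_mul]
  conv_rhs => rw [← h]
  ring

/-- The finite Jacobi triple product: the `q`-binomial theorem of order `2N + 1`, its terms paired
around the middle. -/
lemma finite_triple_product {p y z : ℂ} (hp : ∀ k : ℕ, p ^ (k + 1) ≠ 1) (hp0 : p ≠ 0)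
    (hyz : y * z = p) (N : ℕ) :
    ∑ i ∈ Finset.range (N + 1), (qPochHom 0 y p i + qPochHom 0 z p (i + 1)) *
      (qPoch p p (N - i) * qPoch p p (N + 1 + i))⁻¹ =
    qPoch y p N * qPoch z p (N + 1) / qPoch p p (2 * N + 1) := by
  have hpN : p ^ N ≠ 0 := pow_ne_zero N hp0
  have hz : z ≠ 0 := by rintro rfl; exact hp0 (by rw [← hyz, mul_zero])
  obtain ⟨x, hx⟩ : ∃ x, x * p ^ N = z := ⟨z / p ^ N, div_mul_cancel₀ _ hpN⟩
  have hx0 : x ≠ 0 := by rintro rfl; exact hz (by rw [← hx, zero_mul])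
  have hH := qPochHom_zero_ne_zero hx0 hp0 N
  have key := q_binomial hp x (2 * N + 1)
  rw [show 2 * N + 1 + 1 = (N + 1) + (N + 1) by ring, Finset.sum_range_add,
    ← Finset.sum_range_reflect _ (N + 1), ← Finset.sum_add_distrib,
    show 2 * N + 1 = N + (N + 1) by ring, qPoch_add x, hx,
    qPoch_eq_qPochHom_mul_reverse (y := y) (by rw [mul_assoc, hx, hyz]) hp0] at key
  apply mul_left_cancel₀ hH
  rw [show 2 * N + 1 = N + (N + 1) by ring, ← mul_div_assoc, ← mul_assoc, ← key, Finset.mul_sum]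
  refine Finset.sum_congr rfl fun i hi => ?_
  obtain ⟨e, rfl⟩ := Nat.exists_eq_add_of_le (Nat.lt_succ_iff.1 (Finset.mem_range.1 hi))
  have e1 : i + e + 1 - 1 - i = e := by omega
  have e2 : i + e - i = e := by omega
  have e3 : i + e + (i + e + 1) - e = i + e + 1 + i := by omega
  have e4 : i + e + (i + e + 1) - (i + e + 1 + i) = e := by omega
  have h1 : qPochHom 0 x p (i + e) * qPochHom 0 y p i = qPochHom 0 x p e := by
    rw [add_comm i e, qPochHom_add, mul_assoc,
      qPochHom_zero_mul_reverse (x := x * p ^ e) (by rw [mul_assoc, mul_assoc, ← pow_add, add_comm e i, hx, hyz]) hp0,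
      mul_one]
  have h2 : qPochHom 0 x p (i + e) * qPochHom 0 z p (i + 1) = qPochHom 0 x p (i + e + 1 + i) := by
    rw [show i + e + 1 + i = (i + e) + (i + 1) by ring, qPochHom_add 0 x p (i + e) (i + 1), hx]
  rw [e1, e2, e3, e4, ← h1, ← h2]
  ring

lemma summable_qPochHom_zero {p : ℂ} (hp1 : ‖p‖ < 1) (c : ℂ) :
    Summable fun n => qPochHom 0 c p n :=
  summable_of_ratio_tendsto (fun n => qPochHom_succ 0 c p n) (tendsto_sub_mul_pow hp1 0 c)
    (by simp)

/-- Jacobi's triple product identity, the bilateral series being folded to a unilateral one. -/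
theorem hasSum_triple_product {p y z : ℂ} (hp1 : ‖p‖ < 1) (hp0 : p ≠ 0) (hyz : y * z = p) :
    HasSum (fun i => qPochHom 0 y p i + qPochHom 0 z p (i + 1))
      (qPochInf y p * qPochInf z p * qPochInf p p) := by
  have hp := pow_succ_ne_one_of_norm_lt_one hp1
  have hpp := qPoch_self_ne_zero hp
  have hpi := qPochInf_ne_zero hp1 hpp
  have hs : Summable (fun i => qPochHom 0 y p i + qPochHom 0 z p (i + 1)) :=
    (summable_qPochHom_zero hp1 y).add ((summable_nat_add_iff 1).2 (summable_qPochHom_zero hp1 z))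
  obtain ⟨C, hC⟩ := exists_norm_inv_qPoch_le hp1 hpp
  have hC' : 0 ≤ C := (norm_nonneg _).trans (hC 0)
  have hinv : ∀ i, Tendsto (fun N => (qPoch p p (N - i) * qPoch p p (N + 1 + i))⁻¹) atTop
      (𝓝 (qPochInf p p * qPochInf p p)⁻¹) := by
    intro i
    have h1 : Tendsto (fun N => qPoch p p (N + 1 + i)) atTop (𝓝 (qPochInf p p)) := by
      simp only [add_assoc]
      exact (tendsto_qPoch hp1 p).comp (tendsto_add_atTop_nat (1 + i))
    exact ((tendsto_qPoch_sub hp1 p i).mul h1).inv₀ (mul_ne_zero hpi hpi)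
  have hl := tendsto_sum_range_mul (C := C * C) (L := (qPochInf p p * qPochInf p p)⁻¹)
    (c := fun N i => (qPoch p p (N - i) * qPoch p p (N + 1 + i))⁻¹) hs hinv
    (Eventually.of_forall fun N i _ => by
      rw [mul_inv, norm_mul]
      exact mul_le_mul (hC _) (hC _) (norm_nonneg _) hC')
  have hr : Tendsto (fun N => qPoch y p N * qPoch z p (N + 1) / qPoch p p (2 * N + 1)) atTop
      (𝓝 (qPochInf y p * qPochInf z p / qPochInf p p)) := by
    have h1 : Tendsto (fun N => qPoch z p (N + 1)) atTop (𝓝 (qPochInf z p)) :=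
      (tendsto_qPoch hp1 z).comp (tendsto_add_atTop_nat 1)
    have h2 : Tendsto (fun N : ℕ => 2 * N + 1) atTop atTop :=
      tendsto_atTop_mono (fun n => by simp only [id]; omega) tendsto_id
    have h3 : Tendsto (fun N => qPoch p p (2 * N + 1)) atTop (𝓝 (qPochInf p p)) :=
      (tendsto_qPoch hp1 p).comp h2
    exact ((tendsto_qPoch hp1 y).mul h1).div h3 hpi
  have h := tendsto_nhds_unique (hl.congr fun N => finite_triple_product hp hp0 hyz N) hr
  have : ∑' i, (qPochHom 0 y p i + qPochHom 0 z p (i + 1)) =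
      qPochInf y p * qPochInf z p * qPochInf p p := by
    field_simp at h
    linear_combination h
  rw [← this]
  exact hs.hasSum

/-! ### The Rogers–Selberg identities -/

lemma qPochInf_zero_left (q : ℂ) : qPochInf 0 q = 1 := by simp [qPochInf]

lemma qPochInf_eq_mul {q : ℂ} (hq1 : ‖q‖ < 1) (a : ℂ) :
    qPochInf a q = (1 - a) * qPochInf (a * q) q := by
  have h1 : Tendsto (fun n => qPoch a q (n + 1)) atTop (𝓝 (qPochInf a q)) :=
    (tendsto_qPoch hq1 a).comp (tendsto_add_atTop_nat 1)
  simp only [qPoch_succ'] at h1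
  exact tendsto_nhds_unique h1 ((tendsto_qPoch hq1 (a * q)).const_mul (1 - a))

lemma qPochHom_zero_sq_mul_pow (q c : ℂ) (n : ℕ) :
    qPochHom 0 1 (q ^ 2) n * qPochHom 0 1 (q ^ 2) n * (c * q ^ 2) ^ n = c ^ n * q ^ (2 * n ^ 2) := by
  induction n with
  | zero => simp [qPochHom_zero]
  | succ n ih =>
    rw [qPochHom_succ, pow_succ (c * q ^ 2), show 2 * (n + 1) ^ 2 = 2 * n ^ 2 + 4 * n + 2 by ring, pow_add,
      pow_add, pow_succ c]
    linear_combination (q ^ (4 * n) * c * q ^ 2) * ih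

/-- Since `2 + 2 + 1 + 2 = 7`, the four Gaussian factors of a term, three in base `q²` and one in base
`q`, merge into one in base `q⁷`. -/
lemma qPochHom_merge (q c d e : ℂ) (h : c * d = e) (n : ℕ) :
    qPochHom 0 1 (q ^ 2) n * qPochHom 0 1 (q ^ 2) n * c ^ n *
      (qPochHom 0 (-d) q n * qPochHom 0 1 (q ^ 2) n) = qPochHom 0 e (q ^ 7) n := by
  subst h
  induction n with
  | zero => simp [qPochHom_zero]
  | succ n ih =>
    simp only [qPochHom_succ, pow_succ c]
    linear_combination (-(q ^ (7 * n)) * c * d) * ih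

lemma one_add_ne_zero_of_norm_lt_one {q : ℂ} (hq1 : ‖q‖ < 1) : 1 + q ≠ 0 := by
  have := qPoch_neg_self_ne_zero hq1 1
  simpa [qPoch] using this

lemma qPoch_neg_sq_ne_zero {q : ℂ} (hq1 : ‖q‖ < 1) (n : ℕ) : qPoch (-q * q) q n ≠ 0 := by
  have := qPoch_neg_self_ne_zero hq1 (n + 1)
  rw [qPoch_succ'] at this
  exact right_ne_zero_of_mul this

lemma vwpFactor_self_div {q : ℂ} (hq1 : ‖q‖ < 1) (n : ℕ) :
    (1 - q) * (vwpFactor q q n / qPoch q q n) = 1 - q ^ (2 * n + 1) := by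
  have h := one_sub_mul_vwpFactor q q n
  rw [← mul_div_assoc, h, mul_div_cancel_right₀ _
    (qPoch_self_ne_zero (pow_succ_ne_one_of_norm_lt_one hq1) n), pow_succ']

lemma vwpFactor_one_div {q : ℂ} (hq1 : ‖q‖ < 1) (n : ℕ) :
    vwpFactor 1 q (n + 1) / qPoch q q (n + 1) = 1 + q ^ (n + 1) := by
  have h := qPoch_self_ne_zero (pow_succ_ne_one_of_norm_lt_one hq1) (n + 1)
  rw [div_eq_iff h, vwpFactor, one_mul, one_mul, qPoch_succ]
  ring

/-- The Rogers–Selberg identity with residues `±2` modulo 7: the first transformation at `α = -q` with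
`a`, `b`, `λ → 0`. -/
lemma rogers_selberg_two {q : ℂ} (hq0 : q ≠ 0) (hq1 : ‖q‖ < 1) :
    HasSum (fun n : ℕ => q ^ (2 * n ^ 2 + 2 * n) /
        (qPoch (-q) q (2 * n) * qPoch (q ^ 2) (q ^ 2) n))
      (qPochsInf [q ^ 2, q ^ 5, q ^ 7] (q ^ 7) / qPochInf (q ^ 2) (q ^ 2)) := by
  have hp1 := norm_sq_lt_one hq1
  have hp7 : ‖q ^ 7‖ < 1 := by
    rw [norm_pow]; exact pow_lt_one₀ (norm_nonneg q) hq1 (by norm_num)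
  have hqq := one_add_ne_zero_of_norm_lt_one hq1
  have key := first_nonterminating hq0 hq1 (α := -q) (lam := 0) (u := 0) (v := 0)
    (by rwa [sub_neg_eq_add]) (by simp) (qPoch_neg_self_ne_zero hq1)
    (by simp [qPoch_zero_left]) (by simp [qPoch_zero_left]) (by simp [qPoch_zero_left])
  simp only [mul_zero, qPoch_zero_left, qPochInf_zero_left, mul_one, div_one] at key
  have hB : ∀ n, qPochHom 0 1 (q ^ 2) n * qPochHom 0 1 (q ^ 2) n * ((-q) ^ 2 * q ^ 2) ^ n *
      firstB (-q) 0 q n = q ^ (2 * n ^ 2 + 2 * n) /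
        (qPoch (-q) q (2 * n) * qPoch (q ^ 2) (q ^ 2) n) := by
    intro n
    rw [qPochHom_zero_sq_mul_pow, firstB]
    simp only [zero_pow two_ne_zero, mul_zero, qPoch_zero_left, mul_one]
    rw [neg_sq, ← pow_mul, ← pow_add, add_comm (2 * n), ← mul_div_assoc, mul_one]
  simp only [hB] at key
  obtain ⟨hs, hg⟩ := key
  have hj := hasSum_triple_product hp7 (pow_ne_zero 7 hq0) (y := q ^ 5) (z := q ^ 2)
    (by rw [← pow_add])
  have hz : ∀ n, qPochHom 0 (q ^ 2) (q ^ 7) (n + 1) =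
      -q ^ (4 * n + 2) * qPochHom 0 (q ^ 5) (q ^ 7) n := by
    intro n
    induction n with
    | zero => simp [qPochHom_zero, qPochHom_succ]
    | succ n ih => rw [qPochHom_succ, ih, qPochHom_succ 0 (q ^ 5)]; ring
  have hterm : ∀ n, (1 - q ^ 2) * (qPochHom 0 1 (q ^ 2) n * qPochHom 0 1 (q ^ 2) n *
      ((-q) ^ 2 * q ^ 2) ^ n * firstA (-q) 0 q n) =
      qPochHom 0 (q ^ 5) (q ^ 7) n + qPochHom 0 (q ^ 2) (q ^ 7) (n + 1) := by
    intro n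
    rw [hz, ← qPochHom_merge q ((-q) ^ 2 * q ^ 2) q (q ^ 5) (by ring), firstA]
    simp only [mul_zero, neg_zero, qPoch_zero_left, mul_one, neg_neg, sub_neg_eq_add]
    have h := vwpFactor_self_div hq1 n
    generalize qPochHom 0 (-q) q n = H1
    generalize qPochHom 0 1 (q ^ 2) n = H2
    generalize ((-q) ^ 2 * q ^ 2) ^ n = Y
    have e1 : (1 - q ^ 2) * (H2 * H2 * Y * ((1 - -q * q ^ (2 * n)) / (1 + q) *
        (vwpFactor q q n * H1 * H2) / qPoch q q n)) = ((1 - q) * (vwpFactor q q n / qPoch q q n)) *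
        (1 + q * q ^ (2 * n)) * (H2 * H2 * Y * (H1 * H2)) := by
      rw [show 1 - q ^ 2 = (1 - q) * (1 + q) by ring]
      field_simp
      ring
    rw [e1, h]
    ring
  have h2 := hg.mul_left (1 - q ^ 2)
  simp only [hterm] at h2
  have h3 := h2.unique hj
  have hqi := qPochInf_ne_zero hp1 (qPoch_self_ne_zero (pow_succ_ne_one_of_norm_lt_one hp1))
  have h4 := qPochInf_eq_mul hp1 (q ^ 2)
  rw [neg_sq, ← mul_assoc, ← h4] at h3
  have h5 : ∑' n : ℕ, q ^ (2 * n ^ 2 + 2 * n) / (qPoch (-q) q (2 * n) * qPoch (q ^ 2) (q ^ 2) n) =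
      qPochsInf [q ^ 2, q ^ 5, q ^ 7] (q ^ 7) / qPochInf (q ^ 2) (q ^ 2) := by
    rw [eq_div_iff hqi]
    simp only [qPochsInf, List.map, List.prod_cons, List.prod_nil, mul_one]
    linear_combination h3
  rw [← h5]
  exact hs.hasSum

/-- The Rogers–Selberg identity with residues `±1` modulo 7: the second transformation at `α = -q`
with `a`, `b`, `λ → 0`. -/
lemma rogers_selberg_one {q : ℂ} (hq0 : q ≠ 0) (hq1 : ‖q‖ < 1) :
    HasSum (fun n : ℕ => q ^ (2 * n ^ 2 + 2 * n) /
        (qPoch (-q) q (2 * n + 1) * qPoch (q ^ 2) (q ^ 2) n))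
      (qPochsInf [q, q ^ 6, q ^ 7] (q ^ 7) / qPochInf (q ^ 2) (q ^ 2)) := by
  have hp1 := norm_sq_lt_one hq1
  have hp7 : ‖q ^ 7‖ < 1 := by
    rw [norm_pow]; exact pow_lt_one₀ (norm_nonneg q) hq1 (by norm_num)
  have hqq := one_add_ne_zero_of_norm_lt_one hq1
  have key := second_nonterminating hq1 (α := -q) (lam := 0) (u := 0) (v := 0)
    (by simp) (qPoch_neg_sq_ne_zero hq1)
    (by simp [qPoch_zero_left]) (by simp [qPoch_zero_left]) (by simp [qPoch_zero_left])
  simp only [mul_zero, qPoch_zero_left, qPochInf_zero_left, mul_one, div_one] at key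
  have hB : ∀ n, qPochHom 0 1 (q ^ 2) n * qPochHom 0 1 (q ^ 2) n * ((-q) ^ 2 * q ^ 2) ^ n *
      secondB (-q) 0 q n = (1 + q) * (q ^ (2 * n ^ 2 + 2 * n) /
        (qPoch (-q) q (2 * n + 1) * qPoch (q ^ 2) (q ^ 2) n)) := by
    intro n
    rw [qPochHom_zero_sq_mul_pow, secondB, qPoch_succ', sub_neg_eq_add]
    simp only [zero_pow two_ne_zero, qPoch_zero_left, mul_one]
    rw [neg_sq, ← pow_mul, ← pow_add, add_comm (2 * n), mul_assoc, ← mul_div_assoc, mul_one,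
      ← mul_div_assoc, mul_div_mul_left _ _ hqq]
  simp only [hB] at key
  obtain ⟨hs, hg⟩ := key
  have hj := hasSum_triple_product hp7 (pow_ne_zero 7 hq0) (y := q ^ 6) (z := q)
    (by rw [← pow_succ])
  have hz : ∀ n, qPochHom 0 q (q ^ 7) (n + 1) =
      -q ^ (2 * n + 1) * qPochHom 0 (q ^ 6) (q ^ 7) n := by
    intro n
    induction n with
    | zero => simp [qPochHom_zero, qPochHom_succ]
    | succ n ih => rw [qPochHom_succ, ih, qPochHom_succ 0 (q ^ 6)]; ring
  have hterm : ∀ n, (1 - q) * (qPochHom 0 1 (q ^ 2) n * qPochHom 0 1 (q ^ 2) n *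
      ((-q) ^ 2 * q ^ 2) ^ n * secondA (-q) 0 q n) =
      qPochHom 0 (q ^ 6) (q ^ 7) n + qPochHom 0 q (q ^ 7) (n + 1) := by
    intro n
    rw [hz, ← qPochHom_merge q ((-q) ^ 2 * q ^ 2) (q * q) (q ^ 6) (by ring), secondA]
    simp only [neg_zero, qPoch_zero_left, mul_one, neg_neg, neg_mul]
    have h := vwpFactor_self_div hq1 n
    generalize qPochHom 0 (-(q * q)) q n = H1
    generalize qPochHom 0 1 (q ^ 2) n = H2
    linear_combination (H2 * H2 * ((-q) ^ 2 * q ^ 2) ^ n * (H1 * H2)) * h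
  have h2 := hg.mul_left (1 - q)
  simp only [hterm] at h2
  have h3 := h2.unique hj
  have hqi := qPochInf_ne_zero hp1 (qPoch_self_ne_zero (pow_succ_ne_one_of_norm_lt_one hp1))
  have h4 := qPochInf_eq_mul hp1 (q ^ 2)
  rw [tsum_mul_left, neg_sq] at h3
  have h5 : ∑' n : ℕ, q ^ (2 * n ^ 2 + 2 * n) /
      (qPoch (-q) q (2 * n + 1) * qPoch (q ^ 2) (q ^ 2) n) =
      qPochsInf [q, q ^ 6, q ^ 7] (q ^ 7) / qPochInf (q ^ 2) (q ^ 2) := by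
    rw [eq_div_iff hqi, h4]
    simp only [qPochsInf, List.map, List.prod_cons, List.prod_nil, mul_one]
    linear_combination h3
  rw [← h5]
  exact ((summable_mul_left_iff hqq).1 hs).hasSum

/-- The Rogers–Selberg identity with residues `±3` modulo 7: the second transformation at `α = -1`
with `a`, `b`, `λ → 0`. -/
lemma rogers_selberg_three {q : ℂ} (hq0 : q ≠ 0) (hq1 : ‖q‖ < 1) :
    HasSum (fun n : ℕ => q ^ (2 * n ^ 2) / (qPoch (-q) q (2 * n) * qPoch (q ^ 2) (q ^ 2) n))
      (qPochsInf [q ^ 3, q ^ 4, q ^ 7] (q ^ 7) / qPochInf (q ^ 2) (q ^ 2)) := by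
  have hp1 := norm_sq_lt_one hq1
  have hp7 : ‖q ^ 7‖ < 1 := by
    rw [norm_pow]; exact pow_lt_one₀ (norm_nonneg q) hq1 (by norm_num)
  have key := second_nonterminating hq1 (α := -1) (lam := 0) (u := 0) (v := 0)
    (by simp) (by simpa using qPoch_neg_self_ne_zero hq1)
    (by simp [qPoch_zero_left]) (by simp [qPoch_zero_left]) (by simp [qPoch_zero_left])
  simp only [mul_zero, qPoch_zero_left, qPochInf_zero_left, mul_one, div_one] at key
  have hB : ∀ n, qPochHom 0 1 (q ^ 2) n * qPochHom 0 1 (q ^ 2) n * ((-1) ^ 2 * q ^ 2) ^ n *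
      secondB (-1) 0 q n = q ^ (2 * n ^ 2) /
        (qPoch (-q) q (2 * n) * qPoch (q ^ 2) (q ^ 2) n) := by
    intro n
    rw [qPochHom_zero_sq_mul_pow, secondB]
    simp only [zero_pow two_ne_zero, qPoch_zero_left, mul_one, neg_one_mul, neg_sq, one_pow,
      one_mul]
    rw [← mul_div_assoc, mul_one]
  simp only [hB] at key
  obtain ⟨hs, hg⟩ := key
  have hj := hasSum_triple_product hp7 (pow_ne_zero 7 hq0) (y := q ^ 4) (z := q ^ 3)
    (by rw [← pow_add])
  have hb := summable_qPochHom_zero hp7 (q ^ 4)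
  have ha := summable_qPochHom_zero hp7 (q ^ 3)
  have hb' : Summable fun n => qPochHom 0 (q ^ 4) (q ^ 7) (n + 1) := (summable_nat_add_iff 1).2 hb
  have ha' : Summable fun n => qPochHom 0 (q ^ 3) (q ^ 7) (n + 1) := (summable_nat_add_iff 1).2 ha
  have hz : ∀ n, qPochHom 0 (q ^ 4) (q ^ 7) n = q ^ n * qPochHom 0 (q ^ 3) (q ^ 7) n := by
    intro n
    induction n with
    | zero => simp [qPochHom_zero]
    | succ n ih => rw [qPochHom_succ, ih, qPochHom_succ 0 (q ^ 3)]; ring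
  have hterm : ∀ n, qPochHom 0 1 (q ^ 2) n * qPochHom 0 1 (q ^ 2) n *
      ((-1) ^ 2 * q ^ 2) ^ n * secondA (-1) 0 q n =
      vwpFactor 1 q n / qPoch q q n * qPochHom 0 (q ^ 3) (q ^ 7) n := by
    intro n
    rw [← qPochHom_merge q ((-1) ^ 2 * q ^ 2) q (q ^ 3) (by ring), secondA]
    simp only [neg_zero, qPoch_zero_left, mul_one, neg_neg, neg_mul, one_mul]
    ring
  simp only [hterm] at hg
  -- the `n`-th term is `q^{n(7n+1)/2} + q^{n(7n-1)/2}` up to sign; the second half is shifted by one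
  have hg' : HasSum (fun n => vwpFactor 1 q (n + 1) / qPoch q q (n + 1) *
      qPochHom 0 (q ^ 3) (q ^ 7) (n + 1)) ((∑' n, qPochHom 0 (q ^ 4) (q ^ 7) (n + 1)) +
        ∑' n, qPochHom 0 (q ^ 3) (q ^ 7) (n + 1)) := by
    refine hasSum_of_forall_eq (hb'.hasSum.add ha'.hasSum) fun n => ?_
    rw [vwpFactor_one_div hq1, hz]
    ring
  have h2 := hg.unique (HasSum.zero_add
    (f := fun n => vwpFactor 1 q n / qPoch q q n * qPochHom 0 (q ^ 3) (q ^ 7) n) hg')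
  have h3 := hj.unique (hb.hasSum.add ha'.hasSum)
  have hqi := qPochInf_ne_zero hp1 (qPoch_self_ne_zero (pow_succ_ne_one_of_norm_lt_one hp1))
  have h5 : ∑' n : ℕ, q ^ (2 * n ^ 2) / (qPoch (-q) q (2 * n) * qPoch (q ^ 2) (q ^ 2) n) =
      qPochsInf [q ^ 3, q ^ 4, q ^ 7] (q ^ 7) / qPochInf (q ^ 2) (q ^ 2) := by
    rw [eq_div_iff hqi]
    simp only [qPochsInf, List.map, List.prod_cons, List.prod_nil, mul_one]
    rw [hb.tsum_eq_zero_add] at h3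
    simp only [vwpFactor, qPoch_zero, qPochHom_zero, neg_sq, one_pow, one_mul, div_one] at h2 h3
    linear_combination h2 - h3
  rw [← h5]
  exact hs.hasSum

/-- The bilateral theta series of the first Rogers–Selberg identity is a folded triple product. -/
lemma hasSum_theta {q : ℂ} (hq0 : q ≠ 0) (hq1 : ‖q‖ < 1) :
    HasSum (fun n : ℤ => (-1 : ℂ) ^ n * q ^ ((7 * n ^ 2 + 3 * n) / 2))
      (qPochsInf [q ^ 2, q ^ 5, q ^ 7] (q ^ 7)) := by
  have hp7 : ‖q ^ 7‖ < 1 := by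
    rw [norm_pow]; exact pow_lt_one₀ (norm_nonneg q) hq1 (by norm_num)
  have h1 : ∀ n : ℕ, qPochHom 0 (q ^ 5) (q ^ 7) n =
      (-1 : ℂ) ^ (n : ℤ) * q ^ ((7 * (n : ℤ) ^ 2 + 3 * (n : ℤ)) / 2) := by
    intro n
    induction n with
    | zero => simp [qPochHom_zero]
    | succ n ih =>
      have e1 : 7 * ((n + 1 : ℕ) : ℤ) ^ 2 + 3 * ((n + 1 : ℕ) : ℤ) =
          7 * (n : ℤ) ^ 2 + 3 * (n : ℤ) + ((7 * n + 5 : ℕ) : ℤ) * 2 := by push_cast; ring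
      rw [qPochHom_succ, ih, e1, Int.add_mul_ediv_right _ _ two_ne_zero, zpow_add₀ hq0,
        zpow_natCast, zpow_natCast, zpow_natCast]
      ring
  have h2 : ∀ n : ℕ, qPochHom 0 (q ^ 2) (q ^ 7) (n + 1) =
      (-1 : ℂ) ^ (-((n : ℤ) + 1)) *
        q ^ ((7 * (-((n : ℤ) + 1)) ^ 2 + 3 * (-((n : ℤ) + 1))) / 2) := by
    intro n
    have e0 : (-1 : ℂ) ^ (-((n : ℤ) + 1)) = (-1) ^ (n + 1) := by
      rw [zpow_neg, ← inv_zpow, inv_neg_one]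
      exact_mod_cast zpow_natCast (-1 : ℂ) (n + 1)
    rw [e0]
    clear e0
    induction n with
    | zero => norm_num [qPochHom_zero, qPochHom_succ]
    | succ n ih =>
      have e1 : 7 * (-(((n + 1 : ℕ) : ℤ) + 1)) ^ 2 + 3 * (-(((n + 1 : ℕ) : ℤ) + 1)) =
          7 * (-((n : ℤ) + 1)) ^ 2 + 3 * (-((n : ℤ) + 1)) + ((7 * n + 9 : ℕ) : ℤ) * 2 := by
        push_cast; ring
      rw [qPochHom_succ, ih, e1, Int.add_mul_ediv_right _ _ two_ne_zero, zpow_add₀ hq0,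
        zpow_natCast]
      ring
  have hs1 := (summable_qPochHom_zero hp7 (q ^ 5)).hasSum
  have hs2 := ((summable_nat_add_iff 1).2 (summable_qPochHom_zero hp7 (q ^ 2))).hasSum
  have hj := hasSum_triple_product hp7 (pow_ne_zero 7 hq0) (y := q ^ 5) (z := q ^ 2)
    (by rw [← pow_add])
  have e : qPochsInf [q ^ 2, q ^ 5, q ^ 7] (q ^ 7) = (∑' n, qPochHom 0 (q ^ 5) (q ^ 7) n) +
      ∑' n, qPochHom 0 (q ^ 2) (q ^ 7) (n + 1) := by
    rw [← hj.unique (hs1.add hs2)]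
    simp only [qPochsInf, List.map, List.prod_cons, List.prod_nil, mul_one]
    ring
  rw [e]
  exact HasSum.of_nat_of_neg_add_one (hasSum_of_forall_eq hs1 h1) (hasSum_of_forall_eq hs2 h2)

end

theorem theorem10p1 (r : ℝ) (hr0 : 0 < r) (hr1 : r < 1) (q : ℂ) (hq : q = (r : ℂ)) :
    -- the first terminating transformation
    (∀ (m : ℕ) (α lam a b : ℂ), α ≠ 0 → lam ≠ 0 → a ≠ 0 → b ≠ 0 →
      1 - α ^ 2 ≠ 0 →
      qPochs [α ^ 2 * a, α ^ 2 * b] (q ^ 2) m ≠ 0 →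
      qPochs [α, q * α, q ^ 2 * lam ^ 2, q ^ 4 / (α ^ 2 * a * b * q ^ (2 * m))] (q ^ 2) m ≠ 0 →
      qPoch (α ^ 2 * q ^ (2 * m + 2)) (q ^ 2) m ≠ 0 →
      qPochs [α ^ 2 * q ^ 2, α ^ 2 * a * b / q ^ 2] (q ^ 2) m /
            qPochs [α ^ 2 * a, α ^ 2 * b] (q ^ 2) m *
          phi [q ^ (-2 * (m : ℤ)), q ^ 2 / a, q ^ 2 / b, lam, q * lam]
            [α, q * α, q ^ 2 * lam ^ 2, q ^ 4 / (α ^ 2 * a * b * q ^ (2 * m))]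
            (q ^ 2) (q ^ 2) =
        ∑ n ∈ Finset.range (m + 1),
          (1 - α ^ 2 * q ^ (4 * n)) *
              qPochs [q ^ (-2 * (m : ℤ)), α ^ 2, q ^ 2 / a, q ^ 2 / b] (q ^ 2) n *
              qPochs [-q, α / lam] q n *
              (α ^ 2 * lam * a * b * q ^ (2 * (m : ℤ) - 2)) ^ n /
            ((1 - α ^ 2) *
              qPochs [q ^ 2, α ^ 2 * q ^ (2 * m + 2), α ^ 2 * a, α ^ 2 * b] (q ^ 2) n *
              qPochs [α, -q * lam] q n)) ∧
    -- the second terminating transformation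
    (∀ (m : ℕ) (α lam a b : ℂ), α ≠ 0 → lam ≠ 0 → a ≠ 0 → b ≠ 0 →
      1 + α ≠ 0 →
      qPochs [α ^ 2 * a, α ^ 2 * b] (q ^ 2) m ≠ 0 →
      qPochs [q * α, q ^ 2 * α, lam ^ 2, q ^ 4 / (α ^ 2 * a * b * q ^ (2 * m))] (q ^ 2) m ≠ 0 →
      qPoch (α ^ 2 * q ^ (2 * m + 2)) (q ^ 2) m ≠ 0 →
      qPoch α q m ≠ 0 →
      qPochs [α ^ 2 * q ^ 2, α ^ 2 * a * b / q ^ 2] (q ^ 2) m /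
            qPochs [α ^ 2 * a, α ^ 2 * b] (q ^ 2) m *
          phi [q ^ (-2 * (m : ℤ)), q ^ 2 / a, q ^ 2 / b, lam, q * lam]
            [q * α, q ^ 2 * α, lam ^ 2, q ^ 4 / (α ^ 2 * a * b * q ^ (2 * m))]
            (q ^ 2) (q ^ 2) =
        ∑ n ∈ Finset.range (m + 1),
          (1 + α * q ^ (2 * n)) *
              qPochs [q ^ (-2 * (m : ℤ)), α ^ 2, q ^ 2 / a, q ^ 2 / b] (q ^ 2) n *
              qPochs [-q, q * α / lam] q n *
              (α ^ 2 * lam * a * b * q ^ (2 * (m : ℤ) - 2)) ^ n /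
            ((1 + α) *
              qPochs [q ^ 2, α ^ 2 * q ^ (2 * m + 2), α ^ 2 * a, α ^ 2 * b] (q ^ 2) n *
              qPochs [α, -lam] q n)) ∧
    -- the limit `m → ∞` of the first transformation
    (∀ α lam a b : ℂ, lam ≠ 0 → a ≠ 0 → b ≠ 0 →
      1 - α ^ 2 ≠ 0 →
      ‖α ^ 2 * a * b / q ^ 2‖ < 1 →
      (∀ n : ℕ, qPochs [α ^ 2 * a, α ^ 2 * b, α, q * α, q ^ 2 * lam ^ 2] (q ^ 2) n ≠ 0) →
      Summable (phiTerm [q ^ 2 / a, q ^ 2 / b, lam, q * lam] [α, q * α, q ^ 2 * lam ^ 2]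
        (q ^ 2) (α ^ 2 * a * b / q ^ 2)) ∧
      HasSum
        (fun n : ℕ =>
          (1 - α ^ 2 * q ^ (4 * n)) *
              qPochs [α ^ 2, q ^ 2 / a, q ^ 2 / b] (q ^ 2) n *
              qPochs [-q, α / lam] q n *
              (-α ^ 2 * lam * a * b) ^ n * q ^ ((n : ℤ) ^ 2 - 3 * (n : ℤ)) /
            ((1 - α ^ 2) *
              qPochs [q ^ 2, α ^ 2 * a, α ^ 2 * b] (q ^ 2) n *
              qPochs [α, -q * lam] q n))
        (qPochsInf [α ^ 2 * q ^ 2, α ^ 2 * a * b / q ^ 2] (q ^ 2) /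
            qPochsInf [α ^ 2 * a, α ^ 2 * b] (q ^ 2) *
          phi [q ^ 2 / a, q ^ 2 / b, lam, q * lam] [α, q * α, q ^ 2 * lam ^ 2]
            (q ^ 2) (α ^ 2 * a * b / q ^ 2))) ∧
    -- the limit `m → ∞` of the second transformation
    (∀ α lam a b : ℂ, lam ≠ 0 → a ≠ 0 → b ≠ 0 →
      1 + α ≠ 0 →
      ‖α ^ 2 * a * b / q ^ 2‖ < 1 →
      (∀ n : ℕ, qPochs [α ^ 2 * a, α ^ 2 * b, q * α, q ^ 2 * α, lam ^ 2] (q ^ 2) n ≠ 0) →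
      (∀ n : ℕ, qPoch α q n ≠ 0) →
      Summable (phiTerm [q ^ 2 / a, q ^ 2 / b, lam, q * lam] [q * α, q ^ 2 * α, lam ^ 2]
        (q ^ 2) (α ^ 2 * a * b / q ^ 2)) ∧
      HasSum
        (fun n : ℕ =>
          (1 + α * q ^ (2 * n)) *
              qPochs [α ^ 2, q ^ 2 / a, q ^ 2 / b] (q ^ 2) n *
              qPochs [-q, q * α / lam] q n *
              (-α ^ 2 * lam * a * b) ^ n * q ^ ((n : ℤ) ^ 2 - 3 * (n : ℤ)) /
            ((1 + α) *
              qPochs [q ^ 2, α ^ 2 * a, α ^ 2 * b] (q ^ 2) n *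
              qPochs [α, -lam] q n))
        (qPochsInf [α ^ 2 * q ^ 2, α ^ 2 * a * b / q ^ 2] (q ^ 2) /
            qPochsInf [α ^ 2 * a, α ^ 2 * b] (q ^ 2) *
          phi [q ^ 2 / a, q ^ 2 / b, lam, q * lam] [q * α, q ^ 2 * α, lam ^ 2]
            (q ^ 2) (α ^ 2 * a * b / q ^ 2))) ∧
    -- the three Rogers-Selberg identities modulo 7
    (Summable (fun n : ℤ => (-1 : ℂ) ^ n * q ^ ((7 * n ^ 2 + 3 * n) / 2)) ∧
      HasSum (fun n : ℕ => q ^ (2 * n ^ 2 + 2 * n) / (qPoch (-q) q (2 * n) * qPoch (q ^ 2) (q ^ 2) n))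
        (1 / qPochInf (q ^ 2) (q ^ 2) *
          ∑' n : ℤ, (-1 : ℂ) ^ n * q ^ ((7 * n ^ 2 + 3 * n) / 2)) ∧
      1 / qPochInf (q ^ 2) (q ^ 2) *
          ∑' n : ℤ, (-1 : ℂ) ^ n * q ^ ((7 * n ^ 2 + 3 * n) / 2) =
        qPochsInf [q ^ 2, q ^ 5, q ^ 7] (q ^ 7) / qPochInf (q ^ 2) (q ^ 2)) ∧
    HasSum
      (fun n : ℕ =>
        q ^ (2 * n ^ 2 + 2 * n) / (qPoch (-q) q (2 * n + 1) * qPoch (q ^ 2) (q ^ 2) n))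
      (qPochsInf [q, q ^ 6, q ^ 7] (q ^ 7) / qPochInf (q ^ 2) (q ^ 2)) ∧
    HasSum
      (fun n : ℕ => q ^ (2 * n ^ 2) / (qPoch (-q) q (2 * n) * qPoch (q ^ 2) (q ^ 2) n))
      (qPochsInf [q ^ 3, q ^ 4, q ^ 7] (q ^ 7) / qPochInf (q ^ 2) (q ^ 2)) := by
  have hq0 : q ≠ 0 := by rw [hq]; exact_mod_cast hr0.ne'
  have hq1 : ‖q‖ < 1 := by rwa [hq, Complex.norm_real, Real.norm_of_nonneg hr0.le]
  have htheta := hasSum_theta hq0 hq1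
  have h2 := rogers_selberg_two hq0 hq1
  have he : 1 / qPochInf (q ^ 2) (q ^ 2) *
      ∑' n : ℤ, (-1 : ℂ) ^ n * q ^ ((7 * n ^ 2 + 3 * n) / 2) =
        qPochsInf [q ^ 2, q ^ 5, q ^ 7] (q ^ 7) / qPochInf (q ^ 2) (q ^ 2) := by
    rw [htheta.tsum_eq, one_div_mul_eq_div]
  exact ⟨first_terminating hq0 hq1, second_terminating hq0 hq1, first_limit hq0 hq1,
    second_limit hq0 hq1, ⟨htheta.summable, he ▸ h2, he⟩, rogers_selberg_one hq0 hq1,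
    rogers_selberg_three hq0 hq1⟩
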